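/- A polytope is \emph{2-neighborly} if the segment joining any two distinct vertices is a face (an edge). A \emph{facet} is a face of codimension one. A $0/1$-polytope (resp. $\{-1,0,1\}$-polytope) is the convex hull of a finite set of points with all coordinates in $\{0,1\}$ (resp. $\{-1,0,1\}$). A \emph{facet complement} of a polytope is the set of its vertices not lying on some given facet. We use two kinds of diagrams to describe combinatorial types. (i) A polytope $P$ has type $(m_0,\{m_1,m_{-1}\})$ if its vertices can be labelled by $0,1,-1$, with $m_s$ vertices labelled $s$, so that the facet complements are exactly the singletons of vertices labelled $0$ and the pairs consisting of a vertex labelled $1$ and a vertex labelled $-1$. (ii) A polytope $P$ has type $(m_0,\dots,m_{2n-1})$ if its vertices can be placed at the vertices $0,1,\dots,2n-1$ (in cyclic order) of a regular $2n$-gon, $m_i$ of them at $i$, so that the facet complements are exactly the pairs of vertices of $P$ placed at opposite vertices $i$, $i+n$ of the $2n$-gon and the triples of vertices of $P$ placed at $i<j<k$ such that the triangle $ijk$ contains the centre of the $2n$-gon in its interior (equivalently, $j-i$, $k-j$ and $i+2n-k$ are all less than $n$). Let $P_{d,v,f}$ denote the convex hull in $\mathbb R^d$ of the $v$ points listed below,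 where a 0/1-vector is written as a string of its coordinates. - $P_{4,6,9}$: $0000$, $0001$, $0010$, $0100$, $1001$, $1110$. - $P_{5,7,12}$: $00000$, $00001$, $00010$, $00100$, $01000$, $10001$, $11110$. - $P_{6,8,15}$: $000000$, $000001$, $000010$, $000100$, $001000$, $010000$, $100001$, $111110$. - $P_{5,8,12}$: $00000$, $00001$, $00010$, $00100$, $01001$, $01110$, $10010$, $10101$. - $P_{5,8,14}$: $00000$, $00001$, $00010$, $00101$, $01011$, $01100$, $10011$, $11000$. - $P_{6,9,15}$: $000000$, $000001$, $000010$, $000100$, $001000$, $010000$, $100001$, $100110$, $111000$. - $P_{9,12,18}$: $000000000$, $000100000$, $001000000$, $010000000$, $100100000$, $111000000$, $000010000$, $000010001$, $000010010$, $000010100$, $000011001$, $000011110$. - $P_{6,10,14}$: $000000$, $000001$, $000010$, $000100$, $001000$, $010000$, $100011$, $101100$, $110101$, $111010$. - $P_{6,10,15}$: $(1,1,1,1,1,0)$, $(1,1,1,1,-1,0)$, $(1,1,1,-1,1,0)$, $(1,1,-1,1,1,0)$, $(1,-1,1,1,-1,0)$, $(1,-1,-1,-1,1,0)$, $(-1,1,1,-1,1,0)$,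 $(-1,1,-1,1,-1,0)$, $(0,0,1,1,0,1)$, $(0,0,-1,0,1,1)$. - $P_{7,14,16}$: $0000000$, $0000001$, $0000010$, $0000100$, $0001000$, $0010000$, $0100000$, $1000011$, $1001100$, $1010101$, $1011010$, $1100110$, $1101001$, $1110000$. For each of these ten polytopes, $P_{d,v,f}$ is $d$-dimensional, its vertices are exactly the $v$ listed points (which are distinct), it has exactly $f$ facets, and it is 2-neighborly. All of them except $P_{6,10,15}$ are $0/1$-polytopes, and $P_{6,10,15}$ is a $\{-1,0,1\}$-polytope. Moreover, in the sense of (i), $P_{4,6,9}$ has type $(0,\{3,3\})$, $P_{5,7,12}$ has type $(0,\{3,4\})$, $P_{6,8,15}$ has type $(0,\{3,5\})$; in the sense of (ii), $P_{5,8,12}$ has type $(1,1,1,1,1,1,1,1)$, $P_{5,8,14}$ has type $(0,1,1,1,0,1,1,1,1,1)$, $P_{6,9,15}$ has type $(1,2,1,2,1,2)$, $P_{9,12,18}$ has type $(3,3,3,3)$. -/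

import Mathlib

/-- The convex hull in `ℝ^d` of the rows of an integer matrix. -/
def rowHull {v d : ℕ} (A : Matrix (Fin v) (Fin d) ℤ) : Set (Fin d → ℝ) :=
  convexHull ℝ (Set.range fun (i : Fin v) (j : Fin d) => (A i j : ℝ))

/-- `P` is the convex hull of a finite set of points all of whose coordinates lie in `C`. -/
def IsPolytopeWithCoords {d : ℕ} (C : Set ℝ) (P : Set (Fin d → ℝ)) : Prop :=
  ∃ S : Set (Fin d → ℝ), S.Finite ∧ (∀ x ∈ S, ∀ j, x j ∈ C) ∧ P = convexHull ℝ S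

/-- A 0/1-polytope. -/
def IsZeroOnePolytope {d : ℕ} (P : Set (Fin d → ℝ)) : Prop :=
  IsPolytopeWithCoords {0, 1} P

/-- A `{-1,0,1}`-polytope. -/
def IsSignPolytope {d : ℕ} (P : Set (Fin d → ℝ)) : Prop :=
  IsPolytopeWithCoords {-1, 0, 1} P

/-- The dimension of the affine hull of a (nonempty) set. -/
noncomputable def affDim {d : ℕ} (P : Set (Fin d → ℝ)) : ℕ :=
  Module.finrank ℝ (vectorSpan ℝ P)

/-- A nonempty face of a polytope `P`: the set of maximisers over `P` of a linear functional
(so `P` itself is a face). -/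
def IsPolytopeFace {d : ℕ} (P F : Set (Fin d → ℝ)) : Prop :=
  F.Nonempty ∧ IsExposed ℝ P F

/-- A facet of `P`: a face of codimension one. -/
def IsPolytopeFacet {d : ℕ} (P F : Set (Fin d → ℝ)) : Prop :=
  IsPolytopeFace P F ∧ affDim F + 1 = affDim P

/-- The set of vertices of a polytope. -/
def polytopeVertices {d : ℕ} (P : Set (Fin d → ℝ)) : Set (Fin d → ℝ) :=
  P.extremePoints ℝ

/-- Any two distinct vertices of `P` form an edge of `P`. -/
def IsTwoNeighborly {d : ℕ} (P : Set (Fin d → ℝ)) : Prop :=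
  ∀ x ∈ polytopeVertices P, ∀ y ∈ polytopeVertices P, x ≠ y → IsPolytopeFace P (segment ℝ x y)

/-- The convex hull of the rows of `A` is a 2-neighborly polytope of dimension `dim` with exactly
`nv` vertices and exactly `nf` facets, its vertices being precisely the rows of `A`. -/
structure IsTwoNeighborlyRealization {v d : ℕ} (A : Matrix (Fin v) (Fin d) ℤ)
    (dim nv nf : ℕ) : Prop where
  dim_eq : affDim (rowHull A) = dim
  vertices_eq : polytopeVertices (rowHull A) =
    Set.range fun (i : Fin v) (j : Fin d) => (A i j : ℝ)
  card_vertices : (polytopeVertices (rowHull A)).ncard = nv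
  card_facets : {F | IsPolytopeFacet (rowHull A) F}.ncard = nf
  neighborly : IsTwoNeighborly (rowHull A)

/-- The sets of vertices of `P` missed by a facet of `P`. -/
def facetComplements {d : ℕ} (P : Set (Fin d → ℝ)) : Set (Set (Fin d → ℝ)) :=
  {S | ∃ F, IsPolytopeFacet P F ∧ S = polytopeVertices P \ F}

/-- The combinatorial type of `P` is given by the one-dimensional Gale diagram
`(m 0, {m 1, m (-1)})`: the vertices of `P` can be labelled by `0, 1, -1`, with `m s` of them
labelled `s`, so that the complements of the facets are exactly the single vertices labelled `0`
and the pairs of vertices with labels `1` and `-1`. -/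
def HasLinearGaleDiagram {d : ℕ} (P : Set (Fin d → ℝ)) (m : SignType → ℕ) : Prop :=
  ∃ c : polytopeVertices P → SignType,
    (∀ s, {p | c p = s}.ncard = m s) ∧
    ∀ S : Set (Fin d → ℝ), S ∈ facetComplements P ↔
      (∃ p, c p = 0 ∧ S = {p.1}) ∨ (∃ p q, c p = 1 ∧ c q = -1 ∧ S = {p.1, q.1})

/-- The combinatorial type of `P` is given by the reduced Gale diagram with centre label `0` and
labels `m 0, …, m (2n-1)` on the vertices of a regular `2n`-gon: the vertices of `P` can be placed
at the vertices of the `2n`-gon, `m i` of them at `i`, so that the complements of the facets are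
exactly the pairs lying at opposite vertices and the triples lying at vertices `i < j < k` that
form a triangle with the centre in its interior, i.e. whose three cyclic gaps `j - i`, `k - j`,
`i + 2n - k` are all less than `n`. -/
def HasReducedGaleDiagram {d : ℕ} (P : Set (Fin d → ℝ)) (n : ℕ) (m : Fin (2 * n) → ℕ) : Prop :=
  ∃ g : polytopeVertices P → Fin (2 * n),
    (∀ i, {p | g p = i}.ncard = m i) ∧
    ∀ S : Set (Fin d → ℝ), S ∈ facetComplements P ↔
      (∃ p q, (g q : ℕ) = (g p : ℕ) + n ∧ S = {p.1, q.1}) ∨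
      (∃ p q r, g p < g q ∧ g q < g r ∧ (g q : ℕ) < (g p : ℕ) + n ∧ (g r : ℕ) < (g q : ℕ) + n ∧
        (g p : ℕ) + n < (g r : ℕ) ∧ S = {p.1, q.1, r.1})

/-- The label function of the one-dimensional Gale diagram `(0, {a, b})`. -/
def linearLabels (a b : ℕ) : SignType → ℕ
  | SignType.zero => 0
  | SignType.pos => a
  | SignType.neg => b

def coordsP_4_6_9 : Matrix (Fin 6) (Fin 4) ℤ :=
  !![0, 0, 0, 0;
    0, 0, 0, 1;
    0, 0, 1, 0;
    0, 1, 0, 0;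
    1, 0, 0, 1;
    1, 1, 1, 0]

def coordsP_5_7_12 : Matrix (Fin 7) (Fin 5) ℤ :=
  !![0, 0, 0, 0, 0;
    0, 0, 0, 0, 1;
    0, 0, 0, 1, 0;
    0, 0, 1, 0, 0;
    0, 1, 0, 0, 0;
    1, 0, 0, 0, 1;
    1, 1, 1, 1, 0]

def coordsP_6_8_15 : Matrix (Fin 8) (Fin 6) ℤ :=
  !![0, 0, 0, 0, 0, 0;
    0, 0, 0, 0, 0, 1;
    0, 0, 0, 0, 1, 0;
    0, 0, 0, 1, 0, 0;
    0, 0, 1, 0, 0, 0;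
    0, 1, 0, 0, 0, 0;
    1, 0, 0, 0, 0, 1;
    1, 1, 1, 1, 1, 0]

def coordsP_5_8_12 : Matrix (Fin 8) (Fin 5) ℤ :=
  !![0, 0, 0, 0, 0;
    0, 0, 0, 0, 1;
    0, 0, 0, 1, 0;
    0, 0, 1, 0, 0;
    0, 1, 0, 0, 1;
    0, 1, 1, 1, 0;
    1, 0, 0, 1, 0;
    1, 0, 1, 0, 1]

def coordsP_5_8_14 : Matrix (Fin 8) (Fin 5) ℤ :=
  !![0, 0, 0, 0, 0;
    0, 0, 0, 0, 1;
    0, 0, 0, 1, 0;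
    0, 0, 1, 0, 1;
    0, 1, 0, 1, 1;
    0, 1, 1, 0, 0;
    1, 0, 0, 1, 1;
    1, 1, 0, 0, 0]

def coordsP_6_9_15 : Matrix (Fin 9) (Fin 6) ℤ :=
  !![0, 0, 0, 0, 0, 0;
    0, 0, 0, 0, 0, 1;
    0, 0, 0, 0, 1, 0;
    0, 0, 0, 1, 0, 0;
    0, 0, 1, 0, 0, 0;
    0, 1, 0, 0, 0, 0;
    1, 0, 0, 0, 0, 1;
    1, 0, 0, 1, 1, 0;
    1, 1, 1, 0, 0, 0]

def coordsP_9_12_18 : Matrix (Fin 12) (Fin 9) ℤ :=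
  !![0, 0, 0, 0, 0, 0, 0, 0, 0;
    0, 0, 0, 1, 0, 0, 0, 0, 0;
    0, 0, 1, 0, 0, 0, 0, 0, 0;
    0, 1, 0, 0, 0, 0, 0, 0, 0;
    1, 0, 0, 1, 0, 0, 0, 0, 0;
    1, 1, 1, 0, 0, 0, 0, 0, 0;
    0, 0, 0, 0, 1, 0, 0, 0, 0;
    0, 0, 0, 0, 1, 0, 0, 0, 1;
    0, 0, 0, 0, 1, 0, 0, 1, 0;
    0, 0, 0, 0, 1, 0, 1, 0, 0;
    0, 0, 0, 0, 1, 1, 0, 0, 1;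
    0, 0, 0, 0, 1, 1, 1, 1, 0]

def coordsP_6_10_14 : Matrix (Fin 10) (Fin 6) ℤ :=
  !![0, 0, 0, 0, 0, 0;
    0, 0, 0, 0, 0, 1;
    0, 0, 0, 0, 1, 0;
    0, 0, 0, 1, 0, 0;
    0, 0, 1, 0, 0, 0;
    0, 1, 0, 0, 0, 0;
    1, 0, 0, 0, 1, 1;
    1, 0, 1, 1, 0, 0;
    1, 1, 0, 1, 0, 1;
    1, 1, 1, 0, 1, 0]

def coordsP_6_10_15 : Matrix (Fin 10) (Fin 6) ℤ :=
  !![1, 1, 1, 1, 1, 0;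
    1, 1, 1, 1, -1, 0;
    1, 1, 1, -1, 1, 0;
    1, 1, -1, 1, 1, 0;
    1, -1, 1, 1, -1, 0;
    1, -1, -1, -1, 1, 0;
    -1, 1, 1, -1, 1, 0;
    -1, 1, -1, 1, -1, 0;
    0, 0, 1, 1, 0, 1;
    0, 0, -1, 0, 1, 1]

def coordsP_7_14_16 : Matrix (Fin 14) (Fin 7) ℤ :=
  !![0, 0, 0, 0, 0, 0, 0;
    0, 0, 0, 0, 0, 0, 1;
    0, 0, 0, 0, 0, 1, 0;
    0, 0, 0, 0, 1, 0, 0;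
    0, 0, 0, 1, 0, 0, 0;
    0, 0, 1, 0, 0, 0, 0;
    0, 1, 0, 0, 0, 0, 0;
    1, 0, 0, 0, 0, 1, 1;
    1, 0, 0, 1, 1, 0, 0;
    1, 0, 1, 0, 1, 0, 1;
    1, 0, 1, 1, 0, 1, 0;
    1, 1, 0, 0, 1, 1, 0;
    1, 1, 0, 1, 0, 0, 1;
    1, 1, 1, 0, 0, 0, 0]

/-! Everything is reduced to finite integer checks through slack vectors. If `l x ≤ c` is valid on
the rows of `A`, the numbers `c - l (row i)` form a nonnegative vector orthogonal to every affine
dependency of the rows, and its zeros are the rows on which the inequality is tight. Facets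
therefore correspond to minimal supports in the cone of nonnegative vectors orthogonal to the
dependencies `G`.

Completeness of a list of facets is proved by double description: the orthant is sliced by one
dependency at a time, and generators whose support contains a listed missed set are discarded. If
nothing remains, every nonzero slack vector has a listed missed set in its support
(`exists_subset_support`), so every proper face lies in a listed facet (`exists_facet`).

The listed faces have codimension one because an affine functional constant on the tight rows could
otherwise be used to shrink the support of the slack, against the antichain condition
(`eq_smul_functional`). Two rows span an edge because the listed facets through both contain no
third row (`isExposed_segment`); the case of equal rows shows that each row is a vertex. The Gale
diagrams then compare finite families of missed index sets. Each polytope needs only a certificate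
checked by the kernel. -/

open scoped NNReal

/-! ### Slicing finitely generated cones -/

section Cone

variable {E : Type*} [AddCommGroup E] [Module ℝ E]

/-- The strict sign on the generators leaves no room for cancellation. This disposes of the
degenerate case in the elimination step below. -/
theorem eq_zero_of_mem_span_of_pos (g : E →ₗ[ℝ] ℝ) {s : Set E} (hs : ∀ r ∈ s, 0 < g r) {p : E}
    (hp : p ∈ Submodule.span ℝ≥0 s) : 0 ≤ g p ∧ (g p = 0 → p = 0) := by
  induction hp using Submodule.span_induction with
  | mem r hr => exact ⟨(hs r hr).le, fun h => absurd h (hs r hr).ne'⟩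
  | zero => simp
  | add x y _ _ ihx ihy =>
    refine ⟨by simpa using add_nonneg ihx.1 ihy.1, fun h => ?_⟩
    rw [map_add] at h
    rw [ihx.2 (by linarith [ihx.1, ihy.1]), ihy.2 (by linarith [ihx.1, ihy.1]), add_zero]
  | smul c x _ ih =>
    rw [NNReal.smul_def, map_smul, smul_eq_mul]
    refine ⟨mul_nonneg c.2 ih.1, fun h => ?_⟩
    rcases mul_eq_zero.1 h with h | h
    · rw [h, zero_smul]
    · rw [ih.2 h, smul_zero]

theorem exists_split_of_mem_span (g : E →ₗ[ℝ] ℝ) {s : Set E} {x : E}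
    (hx : x ∈ Submodule.span ℝ≥0 s) :
    ∃ z ∈ Submodule.span ℝ≥0 {r ∈ s | g r = 0}, ∃ p ∈ Submodule.span ℝ≥0 {r ∈ s | 0 < g r},
      ∃ n ∈ Submodule.span ℝ≥0 {r ∈ s | g r < 0}, x = z + p + n := by
  induction hx using Submodule.span_induction with
  | mem r hr =>
    rcases lt_trichotomy (g r) 0 with h | h | h
    · exact ⟨0, zero_mem _, 0, zero_mem _, r, Submodule.subset_span ⟨hr, h⟩, by simp⟩
    · exact ⟨r, Submodule.subset_span ⟨hr, h⟩, 0, zero_mem _, 0, zero_mem _, by simp⟩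
    · exact ⟨0, zero_mem _, r, Submodule.subset_span ⟨hr, h⟩, 0, zero_mem _, by simp⟩
  | zero => exact ⟨0, zero_mem _, 0, zero_mem _, 0, zero_mem _, by simp⟩
  | add x y _ _ ihx ihy =>
    obtain ⟨z, hz, p, hp, n, hn, rfl⟩ := ihx
    obtain ⟨z', hz', p', hp', n', hn', rfl⟩ := ihy
    exact ⟨_, add_mem hz hz', _, add_mem hp hp', _, add_mem hn hn', by abel⟩
  | smul c x _ ih =>
    obtain ⟨z, hz, p, hp, n, hn, rfl⟩ := ih
    exact ⟨_, Submodule.smul_mem _ c hz, _, Submodule.smul_mem _ c hp, _,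
      Submodule.smul_mem _ c hn, by simp⟩

/-- Elimination step of the double description method: the slice of a finitely generated cone by
a hyperplane is generated by the generators on the hyperplane and the positive combinations of two
generators on different sides of it. -/
theorem mem_of_mem_span_of_eq_zero (g : E →ₗ[ℝ] ℝ)
    {s : Set E} (T : Submodule ℝ≥0 E) (h0 : ∀ r ∈ s, g r = 0 → r ∈ T)
    (hc : ∀ r ∈ s, ∀ q ∈ s, 0 < g r → g q < 0 → (-g q) • r + g r • q ∈ T)
    {x : E} (hx : x ∈ Submodule.span ℝ≥0 s) (hgx : g x = 0) : x ∈ T := by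
  obtain ⟨z, hz, p, hp, n, hn, rfl⟩ := exists_split_of_mem_span g hx
  have hzT : z ∈ T := Submodule.span_le.2 (fun r hr => h0 r hr.1 hr.2) hz
  have hgz : g z = 0 := by
    clear hgx hx hzT
    induction hz using Submodule.span_induction with
    | mem r hr => exact hr.2
    | zero => simp
    | add x y _ _ ihx ihy => rw [map_add, ihx, ihy, add_zero]
    | smul c x _ ih => rw [NNReal.smul_def, map_smul, ih, smul_zero]
  have hpos := eq_zero_of_mem_span_of_pos g (fun r hr => hr.2) hp
  have hneg := eq_zero_of_mem_span_of_pos (-g) (fun r hr => by simpa using hr.2) hn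
  -- The expression is additive and positively homogeneous in `p` and in `n` separately, so it
  -- suffices to check it on pairs of generators.
  have hpair : (-g n) • p + g p • n ∈ T := by
    clear hgx hx hneg hpos
    induction hp using Submodule.span_induction with
    | mem r hr =>
      induction hn using Submodule.span_induction with
      | mem q hq => exact hc r hr.1 q hq.1 hr.2 hq.2
      | zero => simp
      | add x y _ _ ihx ihy =>
        convert add_mem ihx ihy using 1
        rw [map_add]; module
      | smul c x _ ih =>
        convert T.smul_mem c ih using 1
        simp only [NNReal.smul_def, map_smul, smul_eq_mul]; module
    | zero => simp
    | add x y _ _ ihx ihy =>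
      convert add_mem ihx ihy using 1
      rw [map_add]; module
    | smul c x _ ih =>
      convert T.smul_mem c ih using 1
      simp only [NNReal.smul_def, map_smul, smul_eq_mul]; module
  have hgn : -g n = g p := by
    rw [map_add, map_add, hgz] at hgx; linarith
  rw [add_assoc]
  refine add_mem hzT ?_
  -- Since `-g n = g p`, the pair expression is `g p • (p + n)`. Either `g p = 0` and both parts
  -- vanish, or it can be divided by `g p`.
  rcases hpos.1.eq_or_lt with h | h
  · rw [hpos.2 h.symm, hneg.2 (by rw [LinearMap.neg_apply, hgn, h]), add_zero]
    exact zero_mem _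
  · rw [hgn, ← smul_add] at hpair
    have : (g p)⁻¹ • g p • (p + n) ∈ T := T.smul_mem ⟨(g p)⁻¹, inv_nonneg.2 h.le⟩ hpair
    rwa [smul_smul, inv_mul_cancel₀ h.ne', one_smul] at this

/-- A vector of a cone generated by nonnegative vectors is generated by those generators that
vanish wherever the vector does. -/
theorem mem_span_of_support {v : ℕ} {s : Set (Fin v → ℝ)} (hs : ∀ r ∈ s, ∀ i, 0 ≤ r i)
    {x : Fin v → ℝ} (hx : x ∈ Submodule.span ℝ≥0 s) :
    (∀ i, 0 ≤ x i) ∧ x ∈ Submodule.span ℝ≥0 {r ∈ s | ∀ i, x i = 0 → r i = 0} := by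
  induction hx using Submodule.span_induction with
  | mem r hr => exact ⟨hs r hr, Submodule.subset_span ⟨hr, fun _ h => h⟩⟩
  | zero => exact ⟨fun _ => le_rfl, zero_mem _⟩
  | add x y _ _ ihx ihy =>
    refine ⟨fun i => add_nonneg (ihx.1 i) (ihy.1 i), add_mem ?_ ?_⟩
    · refine Submodule.span_mono ?_ ihx.2
      refine fun r hr => ⟨hr.1, fun i hi => hr.2 i ?_⟩
      have : x i + y i = 0 := hi
      linarith [ihx.1 i, ihy.1 i]
    · refine Submodule.span_mono ?_ ihy.2
      refine fun r hr => ⟨hr.1, fun i hi => hr.2 i ?_⟩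
      have : x i + y i = 0 := hi
      linarith [ihx.1 i, ihy.1 i]
  | smul c x _ ih =>
    refine ⟨fun i => mul_nonneg c.2 (ih.1 i), ?_⟩
    rcases eq_or_ne c 0 with rfl | hc
    · simp
    · refine Submodule.smul_mem _ c (Submodule.span_mono ?_ ih.2)
      refine fun r hr => ⟨hr.1, fun i hi => hr.2 i ?_⟩
      have : (c : ℝ) * x i = 0 := hi
      exact (mul_eq_zero.1 this).resolve_left (by exact_mod_cast hc)

end Cone

/-! ### Double description on integer lists, with pruning -/

section DoubleDescription

def listDot (g r : List ℤ) : ℤ := (List.zipWith (· * ·) g r).sum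

/-- For `r` on the positive and `s` on the negative side of `g`, the positive combination lying on
the hyperplane. -/
def combine (g r s : List ℤ) : List ℤ :=
  List.zipWith (fun a b => -listDot g s * a + listDot g r * b) r s

/-- No member of `C` lies in the support of `r`. -/
def avoids (C : List (List ℕ)) (r : List ℤ) : Bool :=
  C.all fun c => c.any fun i => r.getD i 0 == 0

/-- One step of the double description method, where all generators whose support contains a
member of `C` are dropped. -/
def sliceCone (C : List (List ℕ)) (R : List (List ℤ)) (g : List ℤ) : List (List ℤ) :=
  (R.filter (fun r => listDot g r = 0) ++
    (R.filter (fun r => 0 < listDot g r)).flatMap fun r =>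
      (R.filter (fun s => listDot g s < 0)).map (combine g r)).filter (avoids C)

def unitVectors (v : ℕ) : List (List ℤ) :=
  (List.range v).map fun i => (List.range v).map fun j => if i = j then 1 else 0

def listVec (v : ℕ) (r : List ℤ) : Fin v → ℝ := fun i => (r.getD i 0 : ℤ)

/-- Only `r` needs length `v`: `zipWith` truncates exactly where `listVec` pads with zeros or cuts
off. -/
theorem listDot_cast {v : ℕ} (g r : List ℤ) (hr : r.length = v) :
    (listDot g r : ℝ) = ∑ i, listVec v g i * listVec v r i := by
  induction r generalizing g v with
  | nil => subst hr; simp [listDot]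
  | cons a r ih =>
    subst hr
    cases g with
    | nil => simp [listDot, listVec]
    | cons b g =>
      have := ih g rfl
      simp only [listDot, listVec] at this
      simp [listDot, listVec, Fin.sum_univ_succ, this]

theorem listVec_combine {v : ℕ} (g r s : List ℤ) (hr : r.length = v) (hs : s.length = v) :
    listVec v (combine g r s) =
      (-(listDot g s : ℝ)) • listVec v r + (listDot g r : ℝ) • listVec v s := by
  funext i
  have h1 : (i : ℕ) < r.length := hr ▸ i.2
  have h2 : (i : ℕ) < s.length := hs ▸ i.2
  simp [listVec, combine, List.getD_eq_getElem?_getD, h1, h2]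

/-- Pruning is sound for a vector whose support contains no member of `C`: in a cone of nonnegative
vectors, it is generated by generators supported inside its own support, and these survive the
filter. All pairs across the hyperplane are combined; redundant generators do no harm. -/
theorem sliceCone_spec {v : ℕ} {C : List (List ℕ)} {R : List (List ℤ)}
    (hR : ∀ r ∈ R, r.length = v ∧ ∀ i, 0 ≤ listVec v r i) (g : List ℤ) {x : Fin v → ℝ}
    (hx : x ∈ Submodule.span ℝ≥0 {y | ∃ r ∈ R, listVec v r = y})
    (hgx : ∑ i, listVec v g i * x i = 0)
    (hxC : ∀ c ∈ C, ∃ i : Fin v, (i : ℕ) ∈ c ∧ x i = 0) :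
    (∀ r ∈ sliceCone C R g, r.length = v ∧ ∀ i, 0 ≤ listVec v r i) ∧
      x ∈ Submodule.span ℝ≥0 {y | ∃ r ∈ sliceCone C R g, listVec v r = y} := by
  set N := R.filter (fun r => listDot g r = 0) ++
    (R.filter (fun r => 0 < listDot g r)).flatMap fun r =>
      (R.filter (fun s => listDot g s < 0)).map (combine g r) with hN
  have hNpos : ∀ r ∈ N, r.length = v ∧ ∀ i, 0 ≤ listVec v r i := by
    intro r hr
    simp only [hN, List.mem_append, List.mem_filter, List.mem_flatMap, List.mem_map,
      decide_eq_true_eq] at hr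
    rcases hr with hr | ⟨r, ⟨hr, hr0⟩, s, ⟨hs, hs0⟩, rfl⟩
    · exact hR r hr.1
    · refine ⟨by simp [combine, (hR r hr).1, (hR s hs).1], fun i => ?_⟩
      rw [listVec_combine g r s (hR r hr).1 (hR s hs).1]
      have h1 : (0 : ℝ) < listDot g r := by exact_mod_cast hr0
      have h2 : (listDot g s : ℝ) < 0 := by exact_mod_cast hs0
      exact add_nonneg (mul_nonneg (by linarith) ((hR r hr).2 i))
        (mul_nonneg h1.le ((hR s hs).2 i))
  refine ⟨fun r hr => hNpos r (List.mem_filter.1 hr).1, ?_⟩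
  let G : (Fin v → ℝ) →ₗ[ℝ] ℝ := Fintype.linearCombination ℝ (listVec v g)
  have hG : ∀ y, G y = ∑ i, listVec v g i * y i := fun y => by
    simp [G, Fintype.linearCombination_apply, mul_comm]
  have hxN : x ∈ Submodule.span ℝ≥0 {y | ∃ r ∈ N, listVec v r = y} := by
    refine mem_of_mem_span_of_eq_zero G _ ?_ ?_ hx (by rw [hG, hgx])
    · rintro _ ⟨r, hr, rfl⟩ h
      rw [hG, ← listDot_cast g r (hR r hr).1] at h
      exact Submodule.subset_span ⟨r, List.mem_append_left _
        (List.mem_filter.2 ⟨hr, by simpa using h⟩), rfl⟩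
    · rintro _ ⟨r, hr, rfl⟩ _ ⟨s, hs, rfl⟩ h1 h2
      rw [hG, ← listDot_cast g _ (hR _ ‹_›).1] at h1 h2
      rw [hG, hG, ← listDot_cast g _ (hR r hr).1, ← listDot_cast g _ (hR s hs).1,
        ← listVec_combine g r s (hR r hr).1 (hR s hs).1]
      refine Submodule.subset_span ⟨_, List.mem_append_right _ (List.mem_flatMap.2
        ⟨r, List.mem_filter.2 ⟨hr, by simpa using h1⟩, List.mem_map.2
          ⟨s, List.mem_filter.2 ⟨hs, by simpa using h2⟩, rfl⟩⟩), rfl⟩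
  refine Submodule.span_mono ?_ (mem_span_of_support ?_ hxN).2
  · rintro _ ⟨⟨r, hr, rfl⟩, hsupp⟩
    refine ⟨r, List.mem_filter.2 ⟨hr, ?_⟩, rfl⟩
    simp only [avoids, List.all_eq_true, List.any_eq_true, beq_iff_eq]
    intro c hc
    obtain ⟨i, hi, hxi⟩ := hxC c hc
    exact ⟨i, hi, by simpa [listVec] using hsupp i hxi⟩
  · rintro _ ⟨r, hr, rfl⟩
    exact (hNpos r hr).2

theorem mem_span_unitVectors {v : ℕ} {x : Fin v → ℝ} (hx : ∀ i, 0 ≤ x i) :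
    x ∈ Submodule.span ℝ≥0 {y | ∃ r ∈ unitVectors v, listVec v r = y} := by
  have : x = ∑ i, x i • (Pi.single i 1 : Fin v → ℝ) := by
    funext j
    simp [Finset.sum_apply, Pi.single_apply]
  rw [this]
  refine sum_mem fun i _ => Submodule.smul_mem _ (⟨x i, hx i⟩ : ℝ≥0) (Submodule.subset_span ?_)
  refine ⟨_, List.mem_map.2 ⟨i, List.mem_range.2 i.2, rfl⟩, ?_⟩
  funext j
  simp [listVec, Pi.single_apply, Fin.ext_iff, eq_comm]

/-- If the double description method for the cone of nonnegative solutions of the equations `G`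
ends with no generators whose support avoids `C`, then the support of every nonzero nonnegative
solution contains a member of `C`. -/
theorem exists_subset_support {v : ℕ} {C : List (List ℕ)} {G : List (List ℤ)}
    (hG : G.foldl (sliceCone C) (unitVectors v) = [])
    {x : Fin v → ℝ} (hx : ∀ i, 0 ≤ x i) (hx0 : x ≠ 0)
    (hGx : ∀ g ∈ G, ∑ i, listVec v g i * x i = 0) :
    ∃ c ∈ C, ∀ i : Fin v, (i : ℕ) ∈ c → x i ≠ 0 := by
  by_contra! hxC
  -- Invariant of the fold: `x` stays in the cone of the surviving generators. With none left at the
  -- end, `x` is zero.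
  have key : ∀ (R : List (List ℤ)), (∀ r ∈ R, r.length = v ∧ ∀ i, 0 ≤ listVec v r i) →
      x ∈ Submodule.span ℝ≥0 {y | ∃ r ∈ R, listVec v r = y} →
      x ∈ Submodule.span ℝ≥0 {y | ∃ r ∈ G.foldl (sliceCone C) R, listVec v r = y} := by
    clear hG
    induction G with
    | nil => exact fun R _ h => h
    | cons g G ih =>
      intro R hR hxR
      have := sliceCone_spec hR g hxR (hGx g (by simp)) hxC
      exact ih (fun g hg => hGx g (by simp [hg])) _ this.1 this.2
  have := key (unitVectors v) ?_ (mem_span_unitVectors hx)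
  · rw [hG] at this
    exact hx0 (by simpa using this)
  · intro r hr
    obtain ⟨i, hi, rfl⟩ := List.mem_map.1 hr
    refine ⟨by simp, fun j => ?_⟩
    change 0 ≤ ((List.getD _ (j : ℕ) 0 : ℤ) : ℝ)
    rw [List.getD_eq_getElem _ _ (by simp), List.getElem_map]
    split_ifs <;> simp

end DoubleDescription

/-! ### Row hulls, facet certificates and slack vectors -/

section Polytope

variable {v d : ℕ}

def realRow (A : Matrix (Fin v) (Fin d) ℤ) (i : Fin v) : Fin d → ℝ := fun j => (A i j : ℝ)

theorem realRow_mem_rowHull (A : Matrix (Fin v) (Fin d) ℤ) (i : Fin v) :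
    realRow A i ∈ rowHull A :=
  subset_convexHull ℝ _ ⟨i, rfl⟩

theorem le_of_mem_rowHull {A : Matrix (Fin v) (Fin d) ℤ} (l : (Fin d → ℝ) →ₗ[ℝ] ℝ) {c : ℝ}
    (hl : ∀ i, l (realRow A i) ≤ c) {x : Fin d → ℝ} (hx : x ∈ rowHull A) : l x ≤ c := by
  refine convexHull_min ?_ (convex_halfSpace_le l.isLinear c) hx
  rintro _ ⟨i, rfl⟩
  exact hl i

/-- A point of the hull at which a family of valid inequalities is tight lies in the hull of the
rows at which these inequalities are tight. -/
theorem mem_convexHull_tight {A : Matrix (Fin v) (Fin d) ℤ} {ι : Type*}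
    (l : ι → (Fin d → ℝ) →ₗ[ℝ] ℝ) (c : ι → ℝ) (hl : ∀ t i, l t (realRow A i) ≤ c t)
    {x : Fin d → ℝ} (hx : x ∈ rowHull A) (hxt : ∀ t, l t x = c t) :
    x ∈ convexHull ℝ (realRow A '' {i | ∀ t, l t (realRow A i) = c t}) := by
  classical
  obtain ⟨κ, _, w, z, hw, hw1, hz, rfl⟩ := mem_convexHull_iff_exists_fintype.1 hx
  have hmem : ∀ k, w k ≠ 0 → z k ∈ realRow A '' {i | ∀ t, l t (realRow A i) = c t} := by
    intro k hk
    obtain ⟨i, hi⟩ := hz k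
    refine ⟨i, fun t => ?_, hi⟩
    -- The weighted slacks are nonnegative with sum zero, so each vanishes, and points of nonzero
    -- weight are tight.
    have hsum : ∑ k, w k * (c t - l t (z k)) = 0 := by
      have := hxt t
      simp only [map_sum, map_smul, smul_eq_mul] at this
      simp only [mul_sub, Finset.sum_sub_distrib, ← Finset.sum_mul, hw1, this, one_mul, sub_self]
    have hnn : ∀ k ∈ Finset.univ, 0 ≤ w k * (c t - l t (z k)) := fun k _ => by
      obtain ⟨m, hm⟩ := hz k
      have := hl t m
      rw [← hm]
      exact mul_nonneg (hw k) (sub_nonneg.2 this)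
    have := (Finset.sum_eq_zero_iff_of_nonneg hnn).1 hsum k (Finset.mem_univ k)
    have := (mul_eq_zero.1 this).resolve_left hk
    rw [← hi] at this
    change c t - l t (realRow A i) = 0 at this
    linarith
  have hx' : ∑ k, w k • z k = ∑ k with w k ≠ 0, w k • z k :=
    (Finset.sum_filter_of_ne (p := fun k => w k ≠ 0) fun k _ hk hwk => hk (by
      rw [hwk, zero_smul])).symm
  rw [hx']
  refine (convex_convexHull ℝ _).sum_mem (fun k _ => hw k) ?_
    fun k hk => subset_convexHull ℝ _ (hmem k (Finset.mem_filter.1 hk).2)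
  rw [Finset.sum_filter_ne_zero, hw1]

/-- A linear inequality `∑ j, normal j * x j ≤ offset`, with the list of the rows of a matrix at
which it is strict. -/
structure FacetData (v d : ℕ) where
  normal : Fin d → ℤ
  offset : ℤ
  missed : List (Fin v)

namespace FacetData

noncomputable def functional (φ : FacetData v d) : StrongDual ℝ (Fin d → ℝ) :=
  ∑ j, (φ.normal j : ℝ) • ContinuousLinearMap.proj j

theorem functional_realRow (φ : FacetData v d) (A : Matrix (Fin v) (Fin d) ℤ) (i : Fin v) :
    φ.functional (realRow A i) = ((∑ j, φ.normal j * A i j : ℤ) : ℝ) := by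
  simp [functional, realRow]

def face (φ : FacetData v d) (A : Matrix (Fin v) (Fin d) ℤ) : Set (Fin d → ℝ) :=
  {x ∈ rowHull A | φ.functional x = φ.offset}

end FacetData

/-- A certificate that `L` lists the facets of the hull of the rows of `A`, and that this hull is
full-dimensional and 2-neighborly. The members of `G` are affine dependencies of the rows, and `B`
expresses `q` times the standard basis by differences of rows. -/
structure IsFacetCertificate (A : Matrix (Fin v) (Fin d) ℤ) (G : List (List ℤ))
    (B : Matrix (Fin d) (Fin v) ℤ) (q : ℤ) (L : List (FacetData v d)) : Prop where
  dependency : ∀ g ∈ G, ∑ i : Fin v, g.getD i 0 = 0 ∧ ∀ j, ∑ i : Fin v, g.getD i 0 * A i j = 0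
  complete : G.foldl (sliceCone (L.map fun φ => φ.missed.map Fin.val)) (unitVectors v) = []
  valid : ∀ φ ∈ L, ∀ i, if i ∈ φ.missed then ∑ j, φ.normal j * A i j < φ.offset
    else ∑ j, φ.normal j * A i j = φ.offset
  proper : ∀ φ ∈ L, (∃ i, i ∈ φ.missed) ∧ ∃ i, i ∉ φ.missed
  antichain : L.Pairwise fun φ ψ =>
    (∃ i ∈ φ.missed, i ∉ ψ.missed) ∧ ∃ i ∈ ψ.missed, i ∉ φ.missed
  separate : ∀ i j m, m ≠ i → m ≠ j → ∃ φ ∈ L, i ∉ φ.missed ∧ j ∉ φ.missed ∧ m ∈ φ.missed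
  scale_ne_zero : q ≠ 0
  spanning : ∀ j, ∑ i, B j i = 0 ∧ ∀ k, ∑ i, B j i * A i k = if j = k then q else 0

theorem apply_realRow (A : Matrix (Fin v) (Fin d) ℤ) (l : (Fin d → ℝ) →ₗ[ℝ] ℝ) (i : Fin v) :
    l (realRow A i) = ∑ j, (A i j : ℝ) * l (Pi.single j 1) := by
  rw [LinearMap.pi_apply_eq_sum_univ l (realRow A i)]
  refine Finset.sum_congr rfl fun j _ => ?_
  rw [smul_eq_mul, realRow]
  congr 2
  funext k
  simp [Pi.single_apply, eq_comm]

namespace IsFacetCertificate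

variable {A : Matrix (Fin v) (Fin d) ℤ} {G : List (List ℤ)} {B : Matrix (Fin d) (Fin v) ℤ}
  {q : ℤ} {L : List (FacetData v d)}

theorem lt_of_mem (h : IsFacetCertificate A G B q L) {φ : FacetData v d} (hφ : φ ∈ L) {i : Fin v}
    (hi : i ∈ φ.missed) : φ.functional (realRow A i) < φ.offset := by
  rw [φ.functional_realRow]
  have := h.valid φ hφ i
  rw [if_pos hi] at this
  exact_mod_cast this

theorem eq_of_notMem (h : IsFacetCertificate A G B q L) {φ : FacetData v d} (hφ : φ ∈ L)
    {i : Fin v} (hi : i ∉ φ.missed) : φ.functional (realRow A i) = φ.offset := by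
  rw [φ.functional_realRow]
  have := h.valid φ hφ i
  rw [if_neg hi] at this
  exact_mod_cast this

theorem eq_iff (h : IsFacetCertificate A G B q L) {φ : FacetData v d} (hφ : φ ∈ L)
    {i : Fin v} : φ.functional (realRow A i) = φ.offset ↔ i ∉ φ.missed :=
  ⟨fun he hi => (h.lt_of_mem hφ hi).ne he, h.eq_of_notMem hφ⟩

theorem le (h : IsFacetCertificate A G B q L) {φ : FacetData v d} (hφ : φ ∈ L) (i : Fin v) :
    φ.functional (realRow A i) ≤ φ.offset := by
  by_cases hi : i ∈ φ.missed
  · exact (h.lt_of_mem hφ hi).le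
  · exact (h.eq_of_notMem hφ hi).le

/-- By `spanning`, `q` times a basis vector is a combination of rows with coefficient sum zero, on
which a functional constant on rows vanishes. -/
theorem eq_zero_of_const (h : IsFacetCertificate A G B q L) (l : (Fin d → ℝ) →ₗ[ℝ] ℝ) {c : ℝ}
    (hl : ∀ i, l (realRow A i) = c) : l = 0 := by
  refine LinearMap.pi_ext' fun j => LinearMap.ext_ring ?_
  obtain ⟨h0, h1⟩ := h.spanning j
  have e1 : (q : ℝ) * l (Pi.single j 1) = ∑ i, (B j i : ℝ) * l (realRow A i) := by
    simp only [apply_realRow, Finset.mul_sum]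
    rw [Finset.sum_comm]
    have : ∀ k, ∑ i, (B j i : ℝ) * ((A i k : ℝ) * l (Pi.single k 1)) =
        (if j = k then (q : ℝ) else 0) * l (Pi.single k 1) := fun k => by
      have := congrArg (fun z : ℤ => (z : ℝ)) (h1 k)
      push_cast at this
      rw [← this, Finset.sum_mul]
      exact Finset.sum_congr rfl fun i _ => by ring
    simp [this]
  have e2 : ∑ i, (B j i : ℝ) * l (realRow A i) = 0 := by
    simp only [hl, ← Finset.sum_mul]
    rw [← Int.cast_sum, h0, Int.cast_zero, zero_mul]
  rw [e2] at e1
  simpa using (mul_eq_zero.1 e1).resolve_left (by exact_mod_cast h.scale_ne_zero)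

/-- The rows attaining a linear inequality valid for all rows, but not attained by all of them,
lie on a listed facet. -/
theorem exists_facet (h : IsFacetCertificate A G B q L) (l : (Fin d → ℝ) →ₗ[ℝ] ℝ) {c : ℝ}
    (hl : ∀ i, l (realRow A i) ≤ c) (hl' : ∃ i, l (realRow A i) ≠ c) :
    ∃ φ ∈ L, ∀ i, l (realRow A i) = c → i ∉ φ.missed := by
  -- Double description is applied to the slack vector of `l`. The affine dependencies annihilate
  -- it: their coefficient sums kill the constant `c`, their coordinate sums kill the linear part.
  obtain ⟨C, hC, hsupp⟩ := exists_subset_support h.complete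
    (x := fun i => c - l (realRow A i)) (fun i => sub_nonneg.2 (hl i))
    (by
      obtain ⟨i, hi⟩ := hl'
      exact fun h0 => hi (sub_eq_zero.1 (congrFun h0 i)).symm)
    (by
      intro g hg
      obtain ⟨h0, h1⟩ := h.dependency g hg
      have e0 : ∑ i : Fin v, listVec v g i = 0 := by
        simp only [listVec, ← Int.cast_sum, h0, Int.cast_zero]
      have e1 : ∀ j, ∑ i : Fin v, listVec v g i * (A i j : ℝ) = 0 := fun j => by
        simp only [listVec, ← Int.cast_mul, ← Int.cast_sum, h1 j, Int.cast_zero]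
      simp only [mul_sub, Finset.sum_sub_distrib, ← Finset.sum_mul, e0, zero_mul, zero_sub,
        apply_realRow, Finset.mul_sum]
      rw [Finset.sum_comm, neg_eq_zero]
      refine Finset.sum_eq_zero fun j _ => ?_
      simp only [← mul_assoc, ← Finset.sum_mul, e1, zero_mul])
  obtain ⟨φ, hφ, rfl⟩ := List.mem_map.1 hC
  exact ⟨φ, hφ, fun i hi hmem => hsupp i (List.mem_map_of_mem hmem) (by simp [hi])⟩

theorem eq_of_subset (h : IsFacetCertificate A G B q L) {φ ψ : FacetData v d} (hφ : φ ∈ L)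
    (hψ : ψ ∈ L) (hsub : ∀ i ∈ φ.missed, i ∈ ψ.missed) : φ = ψ := by
  by_contra hne
  have : Std.Symm fun φ ψ : FacetData v d =>
      (∃ i ∈ φ.missed, i ∉ ψ.missed) ∧ ∃ i ∈ ψ.missed, i ∉ φ.missed := ⟨fun _ _ h => h.symm⟩
  obtain ⟨⟨i, hi, hi'⟩, -⟩ := h.antichain.forall hφ hψ hne
  exact hi' (hsub i hi)

theorem functional_ne_zero (h : IsFacetCertificate A G B q L) {φ : FacetData v d} (hφ : φ ∈ L) :
    φ.functional.toLinearMap ≠ 0 := by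
  intro h0
  obtain ⟨⟨i, hi⟩, j, hj⟩ := h.proper φ hφ
  have h1 := h.lt_of_mem hφ hi
  have h2 := h.eq_of_notMem hφ hj
  have h3 : ∀ x, φ.functional x = 0 := fun x => LinearMap.congr_fun h0 x
  rw [h3] at h1 h2
  linarith

/-- An affine functional vanishing at all rows on a listed facet is a multiple of the functional
defining this facet. -/
theorem eq_smul_functional (h : IsFacetCertificate A G B q L) {φ : FacetData v d} (hφ : φ ∈ L)
    (m : (Fin d → ℝ) →ₗ[ℝ] ℝ) {c : ℝ} (hm : ∀ i, i ∉ φ.missed → m (realRow A i) = c) :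
    ∃ a : ℝ, m = a • φ.functional.toLinearMap := by
  classical
  set y : Fin v → ℝ := fun i => c - m (realRow A i) with hy
  set s : Fin v → ℝ := fun i => φ.offset - φ.functional (realRow A i) with hs
  have hs0 : ∀ i, 0 ≤ s i := fun i => sub_nonneg.2 (h.le hφ i)
  have hspos : ∀ i ∈ φ.missed, 0 < s i := fun i hi => sub_pos.2 (h.lt_of_mem hφ hi)
  have hy0 : ∀ i, i ∉ φ.missed → y i = 0 := fun i hi => sub_eq_zero.2 (hm i hi).symm
  by_cases hyz : ∀ i, y i = 0
  · exact ⟨0, by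
      rw [zero_smul]
      exact h.eq_zero_of_const m fun i => (sub_eq_zero.1 (hyz i)).symm⟩
  push Not at hyz
  obtain ⟨i0, hi0⟩ := hyz
  have hmis0 : i0 ∈ φ.missed := by_contra fun hn => hi0 (hy0 i0 hn)
  -- Ratio test: where `|y i| / s i` is largest, moving from `s` along `y` by the `t` below makes
  -- the slack vanish at `i1` and keeps all others nonnegative.
  obtain ⟨i1, hi1, hmax⟩ := Finset.exists_max_image φ.missed.toFinset (fun i => |y i| / s i)
    ⟨i0, List.mem_toFinset.2 hmis0⟩
  rw [List.mem_toFinset] at hi1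
  have hy1 : y i1 ≠ 0 := by
    intro h1
    have := hmax i0 (List.mem_toFinset.2 hmis0)
    simp only [h1, abs_zero, zero_div] at this
    have h2 := div_pos (abs_pos.2 hi0) (hspos i0 hmis0)
    linarith
  set t : ℝ := -(s i1 / y i1) with ht
  have ht0 : t ≠ 0 := neg_ne_zero.2 (div_ne_zero (hspos i1 hi1).ne' hy1)
  have hz0 : ∀ i, 0 ≤ s i + t * y i := by
    intro i
    by_cases hi : i ∈ φ.missed
    · have h1 := hmax i (List.mem_toFinset.2 hi)
      rw [div_le_div_iff₀ (hspos i hi) (hspos i1 hi1)] at h1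
      have h2 : |t * y i| ≤ s i := by
        rw [ht, abs_mul, abs_neg, abs_div, abs_of_pos (hspos i1 hi1), div_mul_eq_mul_div,
          div_le_iff₀ (abs_pos.2 hy1)]
        linarith
      linarith [neg_abs_le (t * y i)]
    · rw [hy0 i hi, mul_zero, add_zero]
      exact hs0 i
  have hz1 : s i1 + t * y i1 = 0 := by
    rw [ht]; field_simp; ring
  set l : (Fin d → ℝ) →ₗ[ℝ] ℝ := φ.functional.toLinearMap + t • m with hl
  have hlz : ∀ i, (φ.offset + t * c) - l (realRow A i) = s i + t * y i := fun i => by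
    simp only [hl, hs, hy, LinearMap.add_apply, LinearMap.smul_apply, smul_eq_mul,
      ContinuousLinearMap.coe_coe]
    ring
  -- If the new slack were nonzero, its support would contain a listed missed set. That set lies
  -- inside `φ.missed`, hence equals it by the antichain condition, yet the slack is zero at `i1`.
  have hlz0 : ∀ i, l (realRow A i) = φ.offset + t * c := by
    by_contra hne
    push Not at hne
    obtain ⟨ψ, hψ, hψ'⟩ := h.exists_facet l (c := φ.offset + t * c)
      (fun i => by linarith [hz0 i, hlz i]) hne
    have : ψ = φ := h.eq_of_subset hψ hφ fun i hi => by
      by_contra hn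
      refine hψ' i ?_ hi
      have := hlz i
      rw [hy0 i hn] at this
      have h2 : s i = 0 := sub_eq_zero.2 (h.eq_of_notMem hφ hn).symm
      rw [h2] at this
      linarith
    subst this
    exact hψ' i1 (by linarith [hlz i1]) hi1
  have hl0 := h.eq_zero_of_const l hlz0
  refine ⟨-t⁻¹, ?_⟩
  have : φ.functional.toLinearMap = -(t • m) := eq_neg_of_add_eq_zero_left hl0
  rw [this, smul_neg, neg_smul, neg_neg, smul_smul, inv_mul_cancel₀ ht0, one_smul]

end IsFacetCertificate

/-- The nonempty faces of the hull of the rows of `A` are its nonempty intersections with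
hyperplanes `l x = c` such that `l x ≤ c` is valid for all rows. -/
theorem isPolytopeFace_iff {A : Matrix (Fin v) (Fin d) ℤ} {F : Set (Fin d → ℝ)} :
    IsPolytopeFace (rowHull A) F ↔ F.Nonempty ∧ ∃ (l : StrongDual ℝ (Fin d → ℝ)) (c : ℝ),
      (∀ i, l (realRow A i) ≤ c) ∧ F = {x ∈ rowHull A | l x = c} := by
  constructor
  · rintro ⟨⟨x, hx⟩, hF⟩
    obtain ⟨l, rfl⟩ := hF ⟨x, hx⟩
    refine ⟨⟨x, hx⟩, l, l x, fun i => hx.2 _ (realRow_mem_rowHull A i), ?_⟩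
    ext y
    constructor
    · exact fun hy => ⟨hy.1, le_antisymm (hx.2 y hy.1) (hy.2 x hx.1)⟩
    · exact fun hy => ⟨hy.1, fun z hz => (hx.2 z hz).trans hy.2.ge⟩
  · rintro ⟨hne, l, c, hl, rfl⟩
    refine ⟨hne, fun ⟨x, hx⟩ => ⟨l, ?_⟩⟩
    ext y
    constructor
    · refine fun hy => ⟨hy.1, fun z hz => ?_⟩
      rw [hy.2]
      exact le_of_mem_rowHull l.toLinearMap hl hz
    · refine fun hy => ⟨hy.1, le_antisymm (le_of_mem_rowHull l.toLinearMap hl hy.1) ?_⟩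
      rw [← hx.2]
      exact hy.2 x hx.1

theorem vectorSpan_le_ker {l : (Fin d → ℝ) →ₗ[ℝ] ℝ} {c : ℝ} {F : Set (Fin d → ℝ)}
    (hl : ∀ x ∈ F, l x = c) : vectorSpan ℝ F ≤ LinearMap.ker l := by
  rw [vectorSpan_def, Submodule.span_le]
  rintro _ ⟨x, hx, y, hy, rfl⟩
  simp [hl x hx, hl y hy]

/-! ### Dimension, facets, edges and vertices from a certificate -/

namespace IsFacetCertificate

variable {A : Matrix (Fin v) (Fin d) ℤ} {G : List (List ℤ)} {B : Matrix (Fin d) (Fin v) ℤ}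
  {q : ℤ} {L : List (FacetData v d)}

theorem realRow_mem_face (h : IsFacetCertificate A G B q L) {φ : FacetData v d} (hφ : φ ∈ L)
    {i : Fin v} : realRow A i ∈ φ.face A ↔ i ∉ φ.missed :=
  ⟨fun hi => (h.eq_iff hφ).1 hi.2, fun hi => ⟨realRow_mem_rowHull A i, h.eq_of_notMem hφ hi⟩⟩

theorem isPolytopeFace (h : IsFacetCertificate A G B q L) {φ : FacetData v d} (hφ : φ ∈ L) :
    IsPolytopeFace (rowHull A) (φ.face A) := by
  obtain ⟨-, i, hi⟩ := h.proper φ hφ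
  exact isPolytopeFace_iff.2 ⟨⟨_, (h.realRow_mem_face hφ).2 hi⟩, φ.functional, φ.offset, h.le hφ,
    rfl⟩

theorem vectorSpan_rowHull (h : IsFacetCertificate A G B q L) (hv : 0 < v) :
    vectorSpan ℝ (rowHull A) = ⊤ := by
  by_contra hne
  obtain ⟨m, hm0, hm⟩ := Submodule.exists_le_ker_of_lt_top _ (lt_top_iff_ne_top.2 hne)
  refine hm0 (h.eq_zero_of_const m (c := m (realRow A ⟨0, hv⟩)) fun i => ?_)
  have : m (realRow A i - realRow A ⟨0, hv⟩) = 0 := hm (vsub_mem_vectorSpan ℝ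
    (realRow_mem_rowHull A i) (realRow_mem_rowHull A _))
  rwa [map_sub, sub_eq_zero] at this

theorem affDim_rowHull (h : IsFacetCertificate A G B q L) (hv : 0 < v) :
    affDim (rowHull A) = d := by
  rw [affDim, h.vectorSpan_rowHull hv, finrank_top, Module.finrank_fin_fun]

/-- By duality: a functional killing the directions of the face is constant on its rows, so by
`eq_smul_functional` it is a multiple of the defining one and kills the whole hyperplane. -/
theorem vectorSpan_face (h : IsFacetCertificate A G B q L) {φ : FacetData v d} (hφ : φ ∈ L) :
    vectorSpan ℝ (φ.face A) = LinearMap.ker φ.functional.toLinearMap := by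
  refine le_antisymm (vectorSpan_le_ker fun x hx => hx.2) fun x hx => ?_
  by_contra hn
  obtain ⟨m, hmx, hm⟩ := Submodule.exists_le_ker_of_notMem hn
  obtain ⟨-, i0, hi0⟩ := h.proper φ hφ
  obtain ⟨a, rfl⟩ := h.eq_smul_functional hφ m (c := m (realRow A i0)) fun i hi => by
    have : m (realRow A i - realRow A i0) = 0 := hm (vsub_mem_vectorSpan ℝ
      ((h.realRow_mem_face hφ).2 hi) ((h.realRow_mem_face hφ).2 hi0))
    rwa [map_sub, sub_eq_zero] at this
  exact hmx (by rw [LinearMap.smul_apply, LinearMap.mem_ker.1 hx, smul_zero])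

theorem affDim_face (h : IsFacetCertificate A G B q L) {φ : FacetData v d} (hφ : φ ∈ L) :
    affDim (φ.face A) + 1 = d := by
  have := Module.Dual.finrank_ker_add_one_of_ne_zero (h.functional_ne_zero hφ)
  rwa [Module.finrank_fin_fun, ← h.vectorSpan_face hφ] at this

/-- The facets of the hull are the listed ones. -/
theorem isPolytopeFacet_iff (h : IsFacetCertificate A G B q L) (hv : 0 < v)
    {F : Set (Fin d → ℝ)} : IsPolytopeFacet (rowHull A) F ↔ ∃ φ ∈ L, φ.face A = F := by
  constructor
  · rintro ⟨hF, hdim⟩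
    rw [h.affDim_rowHull hv] at hdim
    obtain ⟨⟨x0, hx0⟩, l, c, hl, rfl⟩ := isPolytopeFace_iff.1 hF
    -- Otherwise `l` is zero and the face is the whole hull, which has the wrong dimension.
    have hl' : ∃ i, l.toLinearMap (realRow A i) ≠ c := by
      by_contra! hall
      have : {x ∈ rowHull A | l x = c} = rowHull A := by
        refine Set.Subset.antisymm (fun x hx => hx.1) fun x hx => ⟨hx, ?_⟩
        have hl0 := h.eq_zero_of_const l.toLinearMap hall
        have e : ∀ y, l y = 0 := fun y => LinearMap.congr_fun hl0 y
        rw [e, ← hx0.2, e]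
      rw [this, h.affDim_rowHull hv] at hdim
      omega
    obtain ⟨φ, hφ, hsub⟩ := h.exists_facet l.toLinearMap hl hl'
    refine ⟨φ, hφ, ?_⟩
    have hle : {x ∈ rowHull A | l x = c} ⊆ φ.face A := by
      intro x hx
      refine ⟨hx.1, ?_⟩
      have hxh := mem_convexHull_tight (fun _ : Unit => l.toLinearMap) (fun _ => c)
        (fun _ => hl) hx.1 (fun _ => hx.2)
      refine convexHull_min ?_ (convex_hyperplane φ.functional.toLinearMap.isLinear φ.offset) hxh
      rintro _ ⟨i, hi, rfl⟩
      exact h.eq_of_notMem hφ (hsub i (hi ()))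
    -- Both faces have codimension one, so the inclusion forces equal direction spaces. Hence `l` is
    -- constant on the listed face too, which gives the reverse inclusion.
    have hspan : vectorSpan ℝ {x ∈ rowHull A | l x = c} = vectorSpan ℝ (φ.face A) := by
      refine Submodule.eq_of_le_of_finrank_eq (vectorSpan_mono ℝ hle) ?_
      have := h.affDim_face hφ
      unfold affDim at this hdim
      omega
    refine Set.Subset.antisymm (fun y hy => ⟨hy.1, ?_⟩) hle
    have h1 : y - x0 ∈ vectorSpan ℝ {x ∈ rowHull A | l x = c} := by
      rw [hspan]
      exact vsub_mem_vectorSpan ℝ hy (hle hx0)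
    have h2 : l (y - x0) = 0 := vectorSpan_le_ker (l := l.toLinearMap) (fun x hx => hx.2) h1
    rw [map_sub, hx0.2] at h2
    linarith
  · rintro ⟨φ, hφ, rfl⟩
    exact ⟨h.isPolytopeFace hφ, by rw [h.affDim_face hφ, h.affDim_rowHull hv]⟩

theorem face_injOn (h : IsFacetCertificate A G B q L) {φ ψ : FacetData v d} (hφ : φ ∈ L)
    (hψ : ψ ∈ L) (he : φ.face A = ψ.face A) : φ = ψ :=
  h.eq_of_subset hφ hψ fun i hi => by
    by_contra hn
    exact (h.realRow_mem_face hφ).1 (he ▸ (h.realRow_mem_face hψ).2 hn) hi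

theorem ncard_facets (h : IsFacetCertificate A G B q L) (hv : 0 < v) :
    {F | IsPolytopeFacet (rowHull A) F}.ncard = L.length := by
  classical
  have hnd : (L.map fun φ => φ.face A).Nodup := by
    refine List.Nodup.map_on (fun φ hφ ψ hψ he => h.face_injOn hφ hψ he) ?_
    refine h.antichain.imp ?_
    rintro φ _ ⟨⟨i, hi, hi'⟩, -⟩ rfl
    exact hi' hi
  have : {F | IsPolytopeFacet (rowHull A) F} = ((L.map fun φ => φ.face A).toFinset : Set _) := by
    ext F
    rw [List.coe_toFinset]
    change IsPolytopeFacet (rowHull A) F ↔ F ∈ (L.map fun φ => φ.face A)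
    rw [h.isPolytopeFacet_iff hv, List.mem_map]
  rw [this, Set.ncard_coe_finset, List.toFinset_card_of_nodup hnd, List.length_map]

/-- The segment is the intersection of the listed facets through both rows: points there are
combinations of rows tight for all of these facets, and `separate` excludes every third row. The
indices may coincide. -/
theorem isExposed_segment (h : IsFacetCertificate A G B q L) (i j : Fin v) :
    IsExposed ℝ (rowHull A) (segment ℝ (realRow A i) (realRow A j)) := by
  classical
  -- Including the hull itself makes the family nonempty, as an intersection of exposed faces
  -- requires.
  set S : Finset (Set (Fin d → ℝ)) := insert (rowHull A)
    ((L.filter fun φ => i ∉ φ.missed ∧ j ∉ φ.missed).map fun φ => φ.face A).toFinset with hS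
  have hface : ∀ {φ}, φ ∈ L → i ∉ φ.missed → j ∉ φ.missed → φ.face A ∈ S := fun hφ hi hj =>
    Finset.mem_insert_of_mem (List.mem_toFinset.2 (List.mem_map.2
      ⟨_, List.mem_filter.2 ⟨hφ, by simp [hi, hj]⟩, rfl⟩))
  have hmem : ∀ F ∈ S, F = rowHull A ∨ ∃ φ ∈ L, i ∉ φ.missed ∧ j ∉ φ.missed ∧ F = φ.face A := by
    intro F hF
    rcases Finset.mem_insert.1 hF with rfl | hF
    · exact Or.inl rfl
    · obtain ⟨φ, hφ, rfl⟩ := List.mem_map.1 (List.mem_toFinset.1 hF)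
      have := List.mem_filter.1 hφ
      exact Or.inr ⟨φ, this.1, by simpa using this.2⟩
  have hseg : segment ℝ (realRow A i) (realRow A j) = ⋂₀ (S : Set (Set (Fin d → ℝ))) := by
    refine Set.Subset.antisymm ?_ fun x hx => ?_
    · refine Set.subset_sInter fun F hF => ?_
      rcases hmem F hF with rfl | ⟨φ, hφ, hi, hj, rfl⟩
      · exact (convex_convexHull ℝ _).segment_subset (realRow_mem_rowHull A i)
          (realRow_mem_rowHull A j)
      · refine Convex.segment_subset ?_ ((h.realRow_mem_face hφ).2 hi)
          ((h.realRow_mem_face hφ).2 hj)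
        exact (convex_convexHull ℝ _).inter
          (convex_hyperplane φ.functional.toLinearMap.isLinear φ.offset)
    · rw [Set.mem_sInter] at hx
      have hxP : x ∈ rowHull A := hx _ (Finset.mem_insert_self _ _)
      have := mem_convexHull_tight
        (fun φ : {φ // φ ∈ L ∧ i ∉ φ.missed ∧ j ∉ φ.missed} => φ.1.functional.toLinearMap)
        (fun φ => φ.1.offset) (fun φ => h.le φ.2.1) hxP
        (fun φ => (hx _ (hface φ.2.1 φ.2.2.1 φ.2.2.2)).2)
      rw [← convexHull_pair]
      refine convexHull_mono ?_ this
      rintro _ ⟨m, hm, rfl⟩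
      by_contra hn
      obtain ⟨φ, hφ, hi, hj, hmφ⟩ := h.separate i j m (fun e => hn (by simp [e]))
        (fun e => hn (by simp [e]))
      exact (h.eq_iff hφ).1 (hm ⟨φ, hφ, hi, hj⟩) hmφ
  rw [hseg]
  refine IsExposed.sInter ⟨_, Finset.mem_insert_self _ _⟩ fun F hF => ?_
  rcases hmem F hF with rfl | ⟨φ, hφ, -, -, rfl⟩
  · exact IsExposed.refl _
  · exact (h.isPolytopeFace hφ).2

theorem polytopeVertices_eq (h : IsFacetCertificate A G B q L) :
    polytopeVertices (rowHull A) = Set.range (realRow A) := by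
  refine Set.Subset.antisymm extremePoints_convexHull_subset ?_
  rintro _ ⟨i, rfl⟩
  -- The degenerate segment is a single point, so its being a face makes it extreme.
  have := (h.isExposed_segment i i).isExtreme
  rwa [segment_same, isExtreme_singleton] at this

theorem realRow_injective (h : IsFacetCertificate A G B q L) :
    Function.Injective (realRow A) := by
  intro i j he
  by_contra hne
  obtain ⟨φ, hφ, hi, -, hj⟩ := h.separate i i j (Ne.symm hne) (Ne.symm hne)
  exact (h.realRow_mem_face hφ).1 (he ▸ (h.realRow_mem_face hφ).2 hi) hj

theorem isTwoNeighborlyRealization (h : IsFacetCertificate A G B q L) (hv : 0 < v) {nf : ℕ}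
    (hnf : L.length = nf) : IsTwoNeighborlyRealization A d v nf where
  dim_eq := h.affDim_rowHull hv
  vertices_eq := h.polytopeVertices_eq
  card_vertices := by
    rw [h.polytopeVertices_eq, ← Set.image_univ, Set.ncard_image_of_injective _ h.realRow_injective,
      Set.ncard_univ, Nat.card_eq_fintype_card, Fintype.card_fin]
  card_facets := by rw [h.ncard_facets hv, hnf]
  neighborly := by
    intro x hx y hy _
    rw [h.polytopeVertices_eq] at hx hy
    obtain ⟨i, rfl⟩ := hx
    obtain ⟨j, rfl⟩ := hy
    exact ⟨⟨_, left_mem_segment ℝ _ _⟩, h.isExposed_segment i j⟩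

theorem mem_facetComplements_iff (h : IsFacetCertificate A G B q L) (hv : 0 < v)
    {S : Set (Fin d → ℝ)} :
    S ∈ facetComplements (rowHull A) ↔ ∃ φ ∈ L, S = realRow A '' {i | i ∈ φ.missed} := by
  have key : ∀ φ ∈ L,
      polytopeVertices (rowHull A) \ φ.face A = realRow A '' {i | i ∈ φ.missed} := by
    intro φ hφ
    rw [h.polytopeVertices_eq]
    ext x
    constructor
    · rintro ⟨⟨i, rfl⟩, hi⟩
      exact ⟨i, by_contra fun hn => hi ((h.realRow_mem_face hφ).2 hn), rfl⟩
    · rintro ⟨i, hi, rfl⟩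
      exact ⟨⟨i, rfl⟩, fun hn => (h.realRow_mem_face hφ).1 hn hi⟩
  constructor
  · rintro ⟨F, hF, rfl⟩
    obtain ⟨φ, hφ, rfl⟩ := (h.isPolytopeFacet_iff hv).1 hF
    exact ⟨φ, hφ, key φ hφ⟩
  · rintro ⟨φ, hφ, rfl⟩
    exact ⟨φ.face A, (h.isPolytopeFacet_iff hv).2 ⟨φ, hφ, rfl⟩, (key φ hφ).symm⟩

/-! ### Transfer of Gale diagrams to row indices -/

noncomputable def vertexEquiv (h : IsFacetCertificate A G B q L) :
    Fin v ≃ polytopeVertices (rowHull A) :=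
  (Equiv.ofInjective _ h.realRow_injective).trans (Equiv.setCongr h.polytopeVertices_eq.symm)

theorem coe_vertexEquiv (h : IsFacetCertificate A G B q L) (i : Fin v) :
    (h.vertexEquiv i : Fin d → ℝ) = realRow A i :=
  rfl

theorem ncard_label (h : IsFacetCertificate A G B q L) {α : Type*} [DecidableEq α]
    (lab : Fin v → α) (a : α) :
    {p | lab (h.vertexEquiv.symm p) = a}.ncard = (Finset.univ.filter fun i => lab i = a).card := by
  rw [← Set.ncard_coe_finset, ← Set.ncard_image_of_injective _ h.vertexEquiv.injective]
  congr 1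
  ext p
  simp

/-- Labelling vertices through `vertexEquiv` turns the diagram into decidable conditions on indices:
`hL` places every missed set in the diagram, while `h0` and `h1` give the converse. -/
theorem hasLinearGaleDiagram (h : IsFacetCertificate A G B q L) (hv : 0 < v)
    (lab : Fin v → SignType) {m : SignType → ℕ}
    (hm : ∀ s, (Finset.univ.filter fun i => lab i = s).card = m s)
    (hL : ∀ φ ∈ L, (∃ i, lab i = 0 ∧ ∀ k, k ∈ φ.missed ↔ k = i) ∨
      ∃ i j, lab i = 1 ∧ lab j = -1 ∧ ∀ k, k ∈ φ.missed ↔ k = i ∨ k = j)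
    (h0 : ∀ i, lab i = 0 → ∃ φ ∈ L, ∀ k, k ∈ φ.missed ↔ k = i)
    (h1 : ∀ i j, lab i = 1 → lab j = -1 → ∃ φ ∈ L, ∀ k, k ∈ φ.missed ↔ k = i ∨ k = j) :
    HasLinearGaleDiagram (rowHull A) m := by
  refine ⟨fun p => lab (h.vertexEquiv.symm p), fun s => by rw [h.ncard_label, hm], fun S => ?_⟩
  rw [h.mem_facetComplements_iff hv]
  constructor
  · rintro ⟨φ, hφ, rfl⟩
    rcases hL φ hφ with ⟨i, hi, hk⟩ | ⟨i, j, hi, hj, hk⟩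
    · refine Or.inl ⟨h.vertexEquiv i, by simpa using hi, ?_⟩
      ext x
      simp [hk, coe_vertexEquiv, eq_comm]
    · refine Or.inr ⟨h.vertexEquiv i, h.vertexEquiv j, by simpa using hi, by simpa using hj, ?_⟩
      ext x
      simp [hk, coe_vertexEquiv, eq_comm]
  · rintro (⟨p, hp, rfl⟩ | ⟨p, r, hp, hr, rfl⟩)
    · obtain ⟨i, rfl⟩ := h.vertexEquiv.surjective p
      obtain ⟨φ, hφ, hk⟩ := h0 i (by simpa using hp)
      refine ⟨φ, hφ, ?_⟩
      ext x
      simp [hk, coe_vertexEquiv, eq_comm]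
    · obtain ⟨i, rfl⟩ := h.vertexEquiv.surjective p
      obtain ⟨j, rfl⟩ := h.vertexEquiv.surjective r
      obtain ⟨φ, hφ, hk⟩ := h1 i j (by simpa using hp) (by simpa using hr)
      refine ⟨φ, hφ, ?_⟩
      ext x
      simp [hk, coe_vertexEquiv, eq_comm]

theorem hasReducedGaleDiagram (h : IsFacetCertificate A G B q L) (hv : 0 < v) (n : ℕ)
    (pos : Fin v → Fin (2 * n)) {m : Fin (2 * n) → ℕ}
    (hm : ∀ s, (Finset.univ.filter fun i => pos i = s).card = m s)
    (hL : ∀ φ ∈ L,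
      (∃ i j, (pos j : ℕ) = (pos i : ℕ) + n ∧ ∀ k, k ∈ φ.missed ↔ k = i ∨ k = j) ∨
      ∃ i j l, pos i < pos j ∧ pos j < pos l ∧ (pos j : ℕ) < (pos i : ℕ) + n ∧
        (pos l : ℕ) < (pos j : ℕ) + n ∧ (pos i : ℕ) + n < (pos l : ℕ) ∧
        ∀ k, k ∈ φ.missed ↔ k = i ∨ k = j ∨ k = l)
    (h2 : ∀ i j, (pos j : ℕ) = (pos i : ℕ) + n → ∃ φ ∈ L, ∀ k, k ∈ φ.missed ↔ k = i ∨ k = j)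
    (h3 : ∀ i j l, pos i < pos j → pos j < pos l → (pos j : ℕ) < (pos i : ℕ) + n →
      (pos l : ℕ) < (pos j : ℕ) + n → (pos i : ℕ) + n < (pos l : ℕ) →
      ∃ φ ∈ L, ∀ k, k ∈ φ.missed ↔ k = i ∨ k = j ∨ k = l) :
    HasReducedGaleDiagram (rowHull A) n m := by
  refine ⟨fun p => pos (h.vertexEquiv.symm p), fun s => by rw [h.ncard_label, hm], fun S => ?_⟩
  rw [h.mem_facetComplements_iff hv]
  constructor
  · rintro ⟨φ, hφ, rfl⟩
    rcases hL φ hφ with ⟨i, j, hij, hk⟩ | ⟨i, j, l, e1, e2, e3, e4, e5, hk⟩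
    · refine Or.inl ⟨h.vertexEquiv i, h.vertexEquiv j, by simpa using hij, ?_⟩
      ext x
      simp [hk, coe_vertexEquiv, eq_comm]
    · refine Or.inr ⟨h.vertexEquiv i, h.vertexEquiv j, h.vertexEquiv l, by simpa using e1,
        by simpa using e2, by simpa using e3, by simpa using e4, by simpa using e5, ?_⟩
      ext x
      simp [hk, coe_vertexEquiv, eq_comm]
  · rintro (⟨p, r, hpr, rfl⟩ | ⟨p, r, t, e1, e2, e3, e4, e5, rfl⟩)
    · obtain ⟨i, rfl⟩ := h.vertexEquiv.surjective p
      obtain ⟨j, rfl⟩ := h.vertexEquiv.surjective r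
      obtain ⟨φ, hφ, hk⟩ := h2 i j (by simpa using hpr)
      refine ⟨φ, hφ, ?_⟩
      ext x
      simp [hk, coe_vertexEquiv, eq_comm]
    · obtain ⟨i, rfl⟩ := h.vertexEquiv.surjective p
      obtain ⟨j, rfl⟩ := h.vertexEquiv.surjective r
      obtain ⟨l, rfl⟩ := h.vertexEquiv.surjective t
      obtain ⟨φ, hφ, hk⟩ := h3 i j l (by simpa using e1) (by simpa using e2) (by simpa using e3)
        (by simpa using e4) (by simpa using e5)
      refine ⟨φ, hφ, ?_⟩
      ext x
      simp [hk, coe_vertexEquiv, eq_comm]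

end IsFacetCertificate

theorem isPolytopeWithCoords_rowHull (A : Matrix (Fin v) (Fin d) ℤ) (C : Set ℝ)
    (hA : ∀ i j, (A i j : ℝ) ∈ C) : IsPolytopeWithCoords C (rowHull A) :=
  ⟨_, Set.finite_range _, by rintro _ ⟨i, rfl⟩ j; exact hA i j, rfl⟩

theorem isZeroOnePolytope_rowHull {A : Matrix (Fin v) (Fin d) ℤ}
    (hA : ∀ p : Fin v × Fin d, A p.1 p.2 = 0 ∨ A p.1 p.2 = 1) : IsZeroOnePolytope (rowHull A) :=
  isPolytopeWithCoords_rowHull A _ fun i j => by rcases hA (i, j) with h | h <;> simp_all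

theorem isSignPolytope_rowHull {A : Matrix (Fin v) (Fin d) ℤ}
    (hA : ∀ p : Fin v × Fin d, A p.1 p.2 = -1 ∨ A p.1 p.2 = 0 ∨ A p.1 p.2 = 1) :
    IsSignPolytope (rowHull A) :=
  isPolytopeWithCoords_rowHull A _ fun i j => by rcases hA (i, j) with h | h | h <;> simp_all

end Polytope

/-! ### Facet lists and certificates of the ten polytopes -/

/-- There is one affine dependency, and each missed set pairs a row of positive coefficient with one
of negative coefficient. -/
def facetsP_4_6_9 : List (FacetData 6 4) :=
  [⟨![0, 1, 0, 1], 1, [0, 2]⟩, ⟨![0, 0, 1, 1], 1, [0, 3]⟩, ⟨![-1, 1, 1, 1], 1, [0, 4]⟩,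
   ⟨![1, 0, -1, -1], 0, [1, 2]⟩, ⟨![1, -1, 0, -1], 0, [1, 3]⟩, ⟨![0, 0, 0, -1], 0, [1, 4]⟩,
   ⟨![0, 0, -1, 0], 0, [2, 5]⟩, ⟨![0, -1, 0, 0], 0, [3, 5]⟩, ⟨![-1, 0, 0, 0], 0, [4, 5]⟩]

theorem isFacetCertificate_P_4_6_9 :
    IsFacetCertificate coordsP_4_6_9
      [[1, 1, -1, -1, -1, 1]]
      !![0, -1, 0, 0, 1, 0; -1, 0, 0, 1, 0, 0; -1, 0, 1, 0, 0, 0; -1, 1, 0, 0, 0, 0]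
      1 facetsP_4_6_9 where
  dependency := by decide +kernel
  complete := by decide +kernel
  valid := by decide +kernel
  proper := by decide +kernel
  antichain := by decide +kernel
  separate := by decide +kernel
  scale_ne_zero := by decide +kernel
  spanning := by decide +kernel

def facetsP_5_7_12 : List (FacetData 7 5) :=
  [⟨![0, 1, 1, -1, 1], 1, [0, 2]⟩, ⟨![0, 1, -1, 1, 1], 1, [0, 3]⟩, ⟨![0, -1, 1, 1, 1], 1, [0, 4]⟩,
   ⟨![-2, 1, 1, 1, 1], 1, [0, 5]⟩, ⟨![1, 0, 0, -1, -1], 0, [1, 2]⟩,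
   ⟨![1, 0, -1, 0, -1], 0, [1, 3]⟩, ⟨![1, -1, 0, 0, -1], 0, [1, 4]⟩,
   ⟨![0, 0, 0, 0, -1], 0, [1, 5]⟩, ⟨![0, 0, 0, -1, 0], 0, [2, 6]⟩, ⟨![0, 0, -1, 0, 0], 0, [3, 6]⟩,
   ⟨![0, -1, 0, 0, 0], 0, [4, 6]⟩, ⟨![-1, 0, 0, 0, 0], 0, [5, 6]⟩]

theorem isFacetCertificate_P_5_7_12 :
    IsFacetCertificate coordsP_5_7_12
      [[2, 1, -1, -1, -1, -1, 1]]
      !![0, -1, 0, 0, 0, 1, 0; -1, 0, 0, 0, 1, 0, 0; -1, 0, 0, 1, 0, 0, 0;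
         -1, 0, 1, 0, 0, 0, 0; -1, 1, 0, 0, 0, 0, 0]
      1 facetsP_5_7_12 where
  dependency := by decide +kernel
  complete := by decide +kernel
  valid := by decide +kernel
  proper := by decide +kernel
  antichain := by decide +kernel
  separate := by decide +kernel
  scale_ne_zero := by decide +kernel
  spanning := by decide +kernel

def facetsP_6_8_15 : List (FacetData 8 6) :=
  [⟨![0, 1, 1, 1, -2, 1], 1, [0, 2]⟩, ⟨![0, 1, 1, -2, 1, 1], 1, [0, 3]⟩,
   ⟨![0, 1, -2, 1, 1, 1], 1, [0, 4]⟩, ⟨![0, -2, 1, 1, 1, 1], 1, [0, 5]⟩,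
   ⟨![-3, 1, 1, 1, 1, 1], 1, [0, 6]⟩, ⟨![1, 0, 0, 0, -1, -1], 0, [1, 2]⟩,
   ⟨![1, 0, 0, -1, 0, -1], 0, [1, 3]⟩, ⟨![1, 0, -1, 0, 0, -1], 0, [1, 4]⟩,
   ⟨![1, -1, 0, 0, 0, -1], 0, [1, 5]⟩, ⟨![0, 0, 0, 0, 0, -1], 0, [1, 6]⟩,
   ⟨![0, 0, 0, 0, -1, 0], 0, [2, 7]⟩, ⟨![0, 0, 0, -1, 0, 0], 0, [3, 7]⟩,
   ⟨![0, 0, -1, 0, 0, 0], 0, [4, 7]⟩, ⟨![0, -1, 0, 0, 0, 0], 0, [5, 7]⟩,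
   ⟨![-1, 0, 0, 0, 0, 0], 0, [6, 7]⟩]

theorem isFacetCertificate_P_6_8_15 :
    IsFacetCertificate coordsP_6_8_15
      [[3, 1, -1, -1, -1, -1, -1, 1]]
      !![0, -1, 0, 0, 0, 0, 1, 0; -1, 0, 0, 0, 0, 1, 0, 0; -1, 0, 0, 0, 1, 0, 0, 0;
         -1, 0, 0, 1, 0, 0, 0, 0; -1, 0, 1, 0, 0, 0, 0, 0; -1, 1, 0, 0, 0, 0, 0, 0]
      1 facetsP_6_8_15 where
  dependency := by decide +kernel
  complete := by decide +kernel
  valid := by decide +kernel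
  proper := by decide +kernel
  antichain := by decide +kernel
  separate := by decide +kernel
  scale_ne_zero := by decide +kernel
  spanning := by decide +kernel

def facetsP_5_8_12 : List (FacetData 8 5) :=
  [⟨![0, -1, 1, 1, 0], 1, [0, 1, 4]⟩, ⟨![-1, 0, 1, 0, 1], 1, [0, 2, 6]⟩,
   ⟨![0, 0, 0, 1, 1], 1, [0, 3]⟩, ⟨![-1, -1, 1, 1, 1], 1, [0, 4, 6]⟩,
   ⟨![1, 1, 0, -1, -1], 0, [1, 2]⟩, ⟨![0, 1, -1, 0, -1], 0, [1, 3, 7]⟩,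
   ⟨![0, 0, 0, 0, -1], 0, [1, 4, 7]⟩, ⟨![1, 0, -1, -1, 0], 0, [2, 3, 5]⟩,
   ⟨![0, 0, 0, -1, 0], 0, [2, 5, 6]⟩, ⟨![0, 0, -1, 0, 0], 0, [3, 5, 7]⟩,
   ⟨![0, -1, 0, 0, 0], 0, [4, 5]⟩, ⟨![-1, 0, 0, 0, 0], 0, [6, 7]⟩]

theorem isFacetCertificate_P_5_8_12 :
    IsFacetCertificate coordsP_5_8_12
      [[1, 1, -1, -1, -1, 1, 0, 0], [1, -1, 1, -1, 0, 0, -1, 1]]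
      !![0, 0, -1, 0, 0, 0, 1, 0; 0, -1, 0, 0, 1, 0, 0, 0; -1, 0, 0, 1, 0, 0, 0, 0;
         -1, 0, 1, 0, 0, 0, 0, 0; -1, 1, 0, 0, 0, 0, 0, 0]
      1 facetsP_5_8_12 where
  dependency := by decide +kernel
  complete := by decide +kernel
  valid := by decide +kernel
  proper := by decide +kernel
  antichain := by decide +kernel
  separate := by decide +kernel
  scale_ne_zero := by decide +kernel
  spanning := by decide +kernel

def facetsP_5_8_14 : List (FacetData 8 5) :=
  [⟨![1, 1, 1, 0, 1], 2, [0, 1, 2]⟩, ⟨![1, 1, 1, 2, -1], 2, [0, 1, 3]⟩,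
   ⟨![0, 0, 1, 1, 0], 1, [0, 1, 7]⟩, ⟨![1, 1, 0, -1, 2], 2, [0, 2, 5]⟩,
   ⟨![0, 1, 0, -1, 1], 1, [0, 2, 6]⟩, ⟨![-1, -1, 0, 1, 1], 1, [0, 5, 7]⟩,
   ⟨![-1, 1, -1, 0, -1], 0, [1, 3, 6]⟩, ⟨![1, -1, 1, 0, -1], 0, [1, 4]⟩,
   ⟨![-1, 1, -1, -1, 0], 0, [2, 3, 6]⟩, ⟨![1, -1, 0, -1, 0], 0, [2, 4, 5]⟩,
   ⟨![0, 0, 0, -1, 0], 0, [2, 4, 6]⟩, ⟨![0, 0, -1, 0, 0], 0, [3, 5]⟩,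
   ⟨![0, -1, 0, 0, 0], 0, [4, 5, 7]⟩, ⟨![-1, 0, 0, 0, 0], 0, [6, 7]⟩]

theorem isFacetCertificate_P_5_8_14 :
    IsFacetCertificate coordsP_5_8_14
      [[-2, 2, 1, -1, -1, 1, 0, 0], [-3, 2, 2, 0, -1, 0, -1, 1]]
      !![1, -1, -1, 0, 0, 0, 1, 0; 1, -1, -1, 0, 1, 0, 0, 0; 0, -1, 0, 1, 0, 0, 0, 0;
         -1, 0, 1, 0, 0, 0, 0, 0; -1, 1, 0, 0, 0, 0, 0, 0]
      1 facetsP_5_8_14 where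
  dependency := by decide +kernel
  complete := by decide +kernel
  valid := by decide +kernel
  proper := by decide +kernel
  antichain := by decide +kernel
  separate := by decide +kernel
  scale_ne_zero := by decide +kernel
  spanning := by decide +kernel

def facetsP_6_9_15 : List (FacetData 9 6) :=
  [⟨![0, 1, 0, 1, 0, 1], 1, [0, 2, 4]⟩, ⟨![0, 0, 1, 1, 0, 1], 1, [0, 2, 5]⟩,
   ⟨![0, 1, 0, 0, 1, 1], 1, [0, 3, 4]⟩, ⟨![0, 0, 1, 0, 1, 1], 1, [0, 3, 5]⟩,
   ⟨![-1, 1, 1, 1, 1, 1], 1, [0, 6]⟩, ⟨![1, 0, -1, 0, -1, -1], 0, [1, 2, 4]⟩,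
   ⟨![1, -1, 0, 0, -1, -1], 0, [1, 2, 5]⟩, ⟨![1, 0, -1, -1, 0, -1], 0, [1, 3, 4]⟩,
   ⟨![1, -1, 0, -1, 0, -1], 0, [1, 3, 5]⟩, ⟨![0, 0, 0, 0, 0, -1], 0, [1, 6]⟩,
   ⟨![0, 0, 0, 0, -1, 0], 0, [2, 7]⟩, ⟨![0, 0, 0, -1, 0, 0], 0, [3, 7]⟩,
   ⟨![0, 0, -1, 0, 0, 0], 0, [4, 8]⟩, ⟨![0, -1, 0, 0, 0, 0], 0, [5, 8]⟩,
   ⟨![-1, 0, 0, 0, 0, 0], 0, [6, 7, 8]⟩]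

theorem isFacetCertificate_P_6_9_15 :
    IsFacetCertificate coordsP_6_9_15
      [[1, 1, -1, -1, 0, 0, -1, 1, 0], [1, 1, 0, 0, -1, -1, -1, 0, 1]]
      !![0, -1, 0, 0, 0, 0, 1, 0, 0; -1, 0, 0, 0, 0, 1, 0, 0, 0; -1, 0, 0, 0, 1, 0, 0, 0, 0;
         -1, 0, 0, 1, 0, 0, 0, 0, 0; -1, 0, 1, 0, 0, 0, 0, 0, 0; -1, 1, 0, 0, 0, 0, 0, 0, 0]
      1 facetsP_6_9_15 where
  dependency := by decide +kernel
  complete := by decide +kernel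
  valid := by decide +kernel
  proper := by decide +kernel
  antichain := by decide +kernel
  separate := by decide +kernel
  scale_ne_zero := by decide +kernel
  spanning := by decide +kernel

/-- The polytope is a join of two copies of `P_{4,6,9}`, separated by the fifth coordinate. Each
facet misses a pair of rows within one copy. -/
def facetsP_9_12_18 : List (FacetData 12 9) :=
  [⟨![0, 1, 0, 1, 1, 0, 0, 0, 0], 1, [0, 2]⟩, ⟨![0, 0, 1, 1, 1, 0, 0, 0, 0], 1, [0, 3]⟩,
   ⟨![-1, 1, 1, 1, 1, 0, 0, 0, 0], 1, [0, 4]⟩, ⟨![1, 0, -1, -1, 0, 0, 0, 0, 0], 0, [1, 2]⟩,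
   ⟨![1, -1, 0, -1, 0, 0, 0, 0, 0], 0, [1, 3]⟩, ⟨![0, 0, 0, -1, 0, 0, 0, 0, 0], 0, [1, 4]⟩,
   ⟨![0, 0, -1, 0, 0, 0, 0, 0, 0], 0, [2, 5]⟩, ⟨![0, -1, 0, 0, 0, 0, 0, 0, 0], 0, [3, 5]⟩,
   ⟨![-1, 0, 0, 0, 0, 0, 0, 0, 0], 0, [4, 5]⟩, ⟨![0, 0, 0, 0, -1, 0, 1, 0, 1], 0, [6, 8]⟩,
   ⟨![0, 0, 0, 0, -1, 0, 0, 1, 1], 0, [6, 9]⟩, ⟨![0, 0, 0, 0, -1, -1, 1, 1, 1], 0, [6, 10]⟩,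
   ⟨![0, 0, 0, 0, 0, 1, 0, -1, -1], 0, [7, 8]⟩, ⟨![0, 0, 0, 0, 0, 1, -1, 0, -1], 0, [7, 9]⟩,
   ⟨![0, 0, 0, 0, 0, 0, 0, 0, -1], 0, [7, 10]⟩, ⟨![0, 0, 0, 0, 0, 0, 0, -1, 0], 0, [8, 11]⟩,
   ⟨![0, 0, 0, 0, 0, 0, -1, 0, 0], 0, [9, 11]⟩, ⟨![0, 0, 0, 0, 0, -1, 0, 0, 0], 0, [10, 11]⟩]

theorem isFacetCertificate_P_9_12_18 :
    IsFacetCertificate coordsP_9_12_18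
      [[1, 1, -1, -1, -1, 1, 0, 0, 0, 0, 0, 0], [0, 0, 0, 0, 0, 0, 1, 1, -1, -1, -1, 1]]
      !![0, -1, 0, 0, 1, 0, 0, 0, 0, 0, 0, 0; -1, 0, 0, 1, 0, 0, 0, 0, 0, 0, 0, 0;
         -1, 0, 1, 0, 0, 0, 0, 0, 0, 0, 0, 0; -1, 1, 0, 0, 0, 0, 0, 0, 0, 0, 0, 0;
         -1, 0, 0, 0, 0, 0, 1, 0, 0, 0, 0, 0; 0, 0, 0, 0, 0, 0, 0, -1, 0, 0, 1, 0;
         0, 0, 0, 0, 0, 0, -1, 0, 0, 1, 0, 0; 0, 0, 0, 0, 0, 0, -1, 0, 1, 0, 0, 0;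
         0, 0, 0, 0, 0, 0, -1, 1, 0, 0, 0, 0]
      1 facetsP_9_12_18 where
  dependency := by decide +kernel
  complete := by decide +kernel
  valid := by decide +kernel
  proper := by decide +kernel
  antichain := by decide +kernel
  separate := by decide +kernel
  scale_ne_zero := by decide +kernel
  spanning := by decide +kernel

def facetsP_6_10_14 : List (FacetData 10 6) :=
  [⟨![-1, 1, 1, 1, 0, 0], 1, [0, 1, 2, 6]⟩, ⟨![-1, 1, 0, 0, 1, 1], 1, [0, 3, 4, 7]⟩,
   ⟨![-1, 0, 1, 1, 1, 1], 1, [0, 5]⟩, ⟨![-2, 1, 1, 1, 1, 1], 1, [0, 6, 7]⟩,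
   ⟨![1, -1, 0, -1, 0, -1], 0, [1, 3, 5, 8]⟩, ⟨![1, 0, -1, 0, 0, -1], 0, [1, 4]⟩,
   ⟨![0, 0, 0, 0, 0, -1], 0, [1, 6, 8]⟩, ⟨![1, 0, 0, -1, -1, 0], 0, [2, 3]⟩,
   ⟨![1, -1, -1, 0, -1, 0], 0, [2, 4, 5, 9]⟩, ⟨![0, 0, 0, 0, -1, 0], 0, [2, 6, 9]⟩,
   ⟨![0, 0, 0, -1, 0, 0], 0, [3, 7, 8]⟩, ⟨![0, 0, -1, 0, 0, 0], 0, [4, 7, 9]⟩,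
   ⟨![0, -1, 0, 0, 0, 0], 0, [5, 8, 9]⟩, ⟨![-1, 0, 0, 0, 0, 0], 0, [6, 7, 8, 9]⟩]

theorem isFacetCertificate_P_6_10_14 :
    IsFacetCertificate coordsP_6_10_14
      [[0, 1, 1, -1, -1, 0, -1, 1, 0, 0], [1, 0, 1, -1, 0, -1, -1, 0, 1, 0],
       [1, 1, 0, 0, -1, -1, -1, 0, 0, 1]]
      !![1, -1, -1, 0, 0, 0, 1, 0, 0, 0; -1, 0, 0, 0, 0, 1, 0, 0, 0, 0;
         -1, 0, 0, 0, 1, 0, 0, 0, 0, 0; -1, 0, 0, 1, 0, 0, 0, 0, 0, 0;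
         -1, 0, 1, 0, 0, 0, 0, 0, 0, 0; -1, 1, 0, 0, 0, 0, 0, 0, 0, 0]
      1 facetsP_6_10_14 where
  dependency := by decide +kernel
  complete := by decide +kernel
  valid := by decide +kernel
  proper := by decide +kernel
  antichain := by decide +kernel
  separate := by decide +kernel
  scale_ne_zero := by decide +kernel
  spanning := by decide +kernel

def facetsP_6_10_15 : List (FacetData 10 6) :=
  [⟨![0, 1, -1, -1, 0, 0], 1, [0, 1, 4, 8]⟩, ⟨![1, 0, -1, 1, -1, 2], 2, [0, 2, 5, 6]⟩,
   ⟨![1, 0, -1, 0, -1, 1], 1, [0, 2, 6, 8]⟩, ⟨![0, 0, 0, -1, -1, 1], 0, [0, 3]⟩,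
   ⟨![1, 1, -1, -1, -1, 1], 1, [0, 4, 6, 8]⟩, ⟨![-1, -1, 0, 1, 1, -1], 0, [1, 2]⟩,
   ⟨![0, -1, 1, 0, 2, 1], 2, [1, 3, 4, 7]⟩, ⟨![0, -1, 1, 0, 1, 0], 1, [1, 3, 7, 9]⟩,
   ⟨![0, 0, 0, 0, 1, 0], 1, [1, 4, 7, 8]⟩, ⟨![-1, 0, 1, 1, 0, -1], 1, [2, 3, 5, 9]⟩,
   ⟨![0, 0, 0, 1, 0, 0], 1, [2, 5, 6, 9]⟩, ⟨![0, 0, 1, 0, 0, 0], 1, [3, 5, 7, 9]⟩,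
   ⟨![0, 1, 0, 0, 0, 1], 1, [4, 5]⟩, ⟨![1, 0, 0, 0, 0, 1], 1, [6, 7]⟩,
   ⟨![0, 0, 0, 0, 0, -1], 0, [8, 9]⟩]

theorem isFacetCertificate_P_6_10_15 :
    IsFacetCertificate coordsP_6_10_15
      [[1, 1, -1, -1, -1, 1, 0, 0, 0, 0], [1, -1, 1, -1, 0, 0, -1, 1, 0, 0],
       [2, 1, -1, -2, 0, 0, 0, 0, -2, 2]]
      !![0, 0, 1, 0, 0, 0, -1, 0, 0, 0; 0, 1, 0, 0, -1, 0, 0, 0, 0, 0;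
         1, 0, 0, -1, 0, 0, 0, 0, 0, 0; 1, 0, -1, 0, 0, 0, 0, 0, 0, 0;
         1, -1, 0, 0, 0, 0, 0, 0, 0, 0; -1, 0, 1, 0, -1, 0, -1, 0, 2, 0]
      -- The scale is 2 here: the combinations of rows in the matrix above produce twice the basis
      -- vectors.
      2 facetsP_6_10_15 where
  dependency := by decide +kernel
  complete := by decide +kernel
  valid := by decide +kernel
  proper := by decide +kernel
  antichain := by decide +kernel
  separate := by decide +kernel
  scale_ne_zero := by decide +kernel
  spanning := by decide +kernel

def facetsP_7_14_16 : List (FacetData 14 7) :=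
  [⟨![1, 0, 0, 0, 0, 0, 0], 1, [0, 1, 2, 3, 4, 5, 6]⟩, ⟨![-1, 1, 1, 1, 1, 0, 0], 1, [0, 1, 2, 7]⟩,
   ⟨![-1, 1, 1, 0, 0, 1, 1], 1, [0, 3, 4, 8]⟩, ⟨![-1, 0, 0, 1, 1, 1, 1], 1, [0, 5, 6, 13]⟩,
   ⟨![-2, 1, 1, 1, 1, 1, 1], 1, [0, 7, 8, 13]⟩, ⟨![1, 0, -1, 0, -1, 0, -1], 0, [1, 3, 5, 9]⟩,
   ⟨![1, -1, 0, -1, 0, 0, -1], 0, [1, 4, 6, 12]⟩, ⟨![0, 0, 0, 0, 0, 0, -1], 0, [1, 7, 9, 12]⟩,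
   ⟨![1, -1, 0, 0, -1, -1, 0], 0, [2, 3, 6, 11]⟩, ⟨![1, 0, -1, -1, 0, -1, 0], 0, [2, 4, 5, 10]⟩,
   ⟨![0, 0, 0, 0, 0, -1, 0], 0, [2, 7, 10, 11]⟩, ⟨![0, 0, 0, 0, -1, 0, 0], 0, [3, 8, 9, 11]⟩,
   ⟨![0, 0, 0, -1, 0, 0, 0], 0, [4, 8, 10, 12]⟩, ⟨![0, 0, -1, 0, 0, 0, 0], 0, [5, 9, 10, 13]⟩,
   ⟨![0, -1, 0, 0, 0, 0, 0], 0, [6, 11, 12, 13]⟩,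
   ⟨![-1, 0, 0, 0, 0, 0, 0], 0, [7, 8, 9, 10, 11, 12, 13]⟩]

theorem isFacetCertificate_P_7_14_16 :
    IsFacetCertificate coordsP_7_14_16
      [[0, 1, 1, -1, -1, 0, 0, -1, 1, 0, 0, 0, 0, 0],
       [1, 0, 1, -1, 0, -1, 0, -1, 0, 1, 0, 0, 0, 0],
       [1, 1, 0, 0, -1, -1, 0, -1, 0, 0, 1, 0, 0, 0],
       [1, 1, 0, -1, 0, 0, -1, -1, 0, 0, 0, 1, 0, 0],
       [1, 0, 1, 0, -1, 0, -1, -1, 0, 0, 0, 0, 1, 0],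
       [0, 1, 1, 0, 0, -1, -1, -1, 0, 0, 0, 0, 0, 1]]
      !![1, -1, -1, 0, 0, 0, 0, 1, 0, 0, 0, 0, 0, 0; -1, 0, 0, 0, 0, 0, 1, 0, 0, 0, 0, 0, 0, 0;
         -1, 0, 0, 0, 0, 1, 0, 0, 0, 0, 0, 0, 0, 0; -1, 0, 0, 0, 1, 0, 0, 0, 0, 0, 0, 0, 0, 0;
         -1, 0, 0, 1, 0, 0, 0, 0, 0, 0, 0, 0, 0, 0; -1, 0, 1, 0, 0, 0, 0, 0, 0, 0, 0, 0, 0, 0;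
         -1, 1, 0, 0, 0, 0, 0, 0, 0, 0, 0, 0, 0, 0]
      1 facetsP_7_14_16 where
  dependency := by decide +kernel
  complete := by decide +kernel
  valid := by decide +kernel
  proper := by decide +kernel
  antichain := by decide +kernel
  separate := by decide +kernel
  scale_ne_zero := by decide +kernel
  spanning := by decide +kernel

/-! ### Assembly, with explicit Gale labels -/

theorem mainTheorem3 :
    (IsZeroOnePolytope (rowHull coordsP_4_6_9) ∧
      IsTwoNeighborlyRealization coordsP_4_6_9 4 6 9 ∧
      HasLinearGaleDiagram (rowHull coordsP_4_6_9) (linearLabels 3 3)) ∧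
    (IsZeroOnePolytope (rowHull coordsP_5_7_12) ∧
      IsTwoNeighborlyRealization coordsP_5_7_12 5 7 12 ∧
      HasLinearGaleDiagram (rowHull coordsP_5_7_12) (linearLabels 3 4)) ∧
    (IsZeroOnePolytope (rowHull coordsP_6_8_15) ∧
      IsTwoNeighborlyRealization coordsP_6_8_15 6 8 15 ∧
      HasLinearGaleDiagram (rowHull coordsP_6_8_15) (linearLabels 3 5)) ∧
    (IsZeroOnePolytope (rowHull coordsP_5_8_12) ∧
      IsTwoNeighborlyRealization coordsP_5_8_12 5 8 12 ∧
      HasReducedGaleDiagram (rowHull coordsP_5_8_12) 4 ![1, 1, 1, 1, 1, 1, 1, 1]) ∧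
    (IsZeroOnePolytope (rowHull coordsP_5_8_14) ∧
      IsTwoNeighborlyRealization coordsP_5_8_14 5 8 14 ∧
      HasReducedGaleDiagram (rowHull coordsP_5_8_14) 5 ![0, 1, 1, 1, 0, 1, 1, 1, 1, 1]) ∧
    (IsZeroOnePolytope (rowHull coordsP_6_9_15) ∧
      IsTwoNeighborlyRealization coordsP_6_9_15 6 9 15 ∧
      HasReducedGaleDiagram (rowHull coordsP_6_9_15) 3 ![1, 2, 1, 2, 1, 2]) ∧
    (IsZeroOnePolytope (rowHull coordsP_9_12_18) ∧
      IsTwoNeighborlyRealization coordsP_9_12_18 9 12 18 ∧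
      HasReducedGaleDiagram (rowHull coordsP_9_12_18) 2 ![3, 3, 3, 3]) ∧
    (IsZeroOnePolytope (rowHull coordsP_6_10_14) ∧
      IsTwoNeighborlyRealization coordsP_6_10_14 6 10 14) ∧
    (IsSignPolytope (rowHull coordsP_6_10_15) ∧
      IsTwoNeighborlyRealization coordsP_6_10_15 6 10 15) ∧
    (IsZeroOnePolytope (rowHull coordsP_7_14_16) ∧
      IsTwoNeighborlyRealization coordsP_7_14_16 7 14 16) :=
  ⟨⟨isZeroOnePolytope_rowHull (by decide +kernel),
      isFacetCertificate_P_4_6_9.isTwoNeighborlyRealization (by norm_num) rfl,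
      isFacetCertificate_P_4_6_9.hasLinearGaleDiagram (by norm_num)
        -- The labels are the signs of the coefficients in the single affine dependency; likewise
        -- for the next two polytopes.
        ![1, 1, -1, -1, -1, 1] (by decide +kernel) (by decide +kernel)
        (by decide +kernel) (by decide +kernel)⟩,
    ⟨isZeroOnePolytope_rowHull (by decide +kernel),
      isFacetCertificate_P_5_7_12.isTwoNeighborlyRealization (by norm_num) rfl,
      isFacetCertificate_P_5_7_12.hasLinearGaleDiagram (by norm_num)
        ![1, 1, -1, -1, -1, -1, 1] (by decide +kernel) (by decide +kernel)
        (by decide +kernel) (by decide +kernel)⟩,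
    ⟨isZeroOnePolytope_rowHull (by decide +kernel),
      isFacetCertificate_P_6_8_15.isTwoNeighborlyRealization (by norm_num) rfl,
      isFacetCertificate_P_6_8_15.hasLinearGaleDiagram (by norm_num)
        ![1, 1, -1, -1, -1, -1, -1, 1] (by decide +kernel) (by decide +kernel)
        (by decide +kernel) (by decide +kernel)⟩,
    ⟨isZeroOnePolytope_rowHull (by decide +kernel),
      isFacetCertificate_P_5_8_12.isTwoNeighborlyRealization (by norm_num) rfl,
      isFacetCertificate_P_5_8_12.hasReducedGaleDiagram (by norm_num) 4
        -- The two dependencies assign to each row a vector in the plane; positions follow the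
        -- cyclic order of these directions, with opposite directions at opposite vertices. The same
        -- rule gives the three remaining diagrams.
        ![0, 2, 6, 4, 5, 1, 3, 7] (by decide +kernel) (by decide +kernel)
        (by decide +kernel) (by decide +kernel)⟩,
    ⟨isZeroOnePolytope_rowHull (by decide +kernel),
      isFacetCertificate_P_5_8_14.isTwoNeighborlyRealization (by norm_num) rfl,
      isFacetCertificate_P_5_8_14.hasReducedGaleDiagram (by norm_num) 5
        ![5, 1, 9, 7, 6, 2, 3, 8] (by decide +kernel) (by decide +kernel)
        (by decide +kernel) (by decide +kernel)⟩,
    ⟨isZeroOnePolytope_rowHull (by decide +kernel),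
      isFacetCertificate_P_6_9_15.isTwoNeighborlyRealization (by norm_num) rfl,
      isFacetCertificate_P_6_9_15.hasReducedGaleDiagram (by norm_num) 3
        ![1, 1, 3, 3, 5, 5, 4, 0, 2] (by decide +kernel) (by decide +kernel)
        (by decide +kernel) (by decide +kernel)⟩,
    ⟨isZeroOnePolytope_rowHull (by decide +kernel),
      isFacetCertificate_P_9_12_18.isTwoNeighborlyRealization (by norm_num) rfl,
      isFacetCertificate_P_9_12_18.hasReducedGaleDiagram (by norm_num) 2
        ![0, 0, 2, 2, 2, 0, 1, 1, 3, 3, 3, 1] (by decide +kernel) (by decide +kernel)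
        (by decide +kernel) (by decide +kernel)⟩,
    ⟨isZeroOnePolytope_rowHull (by decide +kernel),
      isFacetCertificate_P_6_10_14.isTwoNeighborlyRealization (by norm_num) rfl⟩,
    ⟨isSignPolytope_rowHull (by decide +kernel),
      isFacetCertificate_P_6_10_15.isTwoNeighborlyRealization (by norm_num) rfl⟩,
    ⟨isZeroOnePolytope_rowHull (by decide +kernel),
      isFacetCertificate_P_7_14_16.isTwoNeighborlyRealization (by norm_num) rfl⟩⟩
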